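/- Let $I\xleftarrow{s}E\xrightarrow{p}B\xrightarrow{t}I$ be a diagram of groupoids, representing a polynomial endofunctor $P$, such that $I$ has finitely many isomorphism classes of objects, with representatives $v_1,\dots,v_s$ (the colours). A *tree* is a diagram of finite sets $A\xleftarrow{s}M\xrightarrow{p}N\xrightarrow{t}A$ (edges $A$, nodes $N$, nodes with a marked input edge $M$) with $s$ and $t$ injective, $A\setminus s(M)$ a singleton (the root), and such that iterating the function $A\to A$ which fixes the root and sends $s(m)$ to $t(p(m))$ eventually takes every edge to the root. The leaves are the edges outside $t(N)$. A *$P$-tree* is a tree together with maps $A\to I$, $M\to E$, $N\to B$ making the three squares commute up to specified isomorphisms, the middle square being homotopy cartesian. Let $\mathbf T$ be the groupoid of $P$-trees and their isomorphisms; assume that every $P$-tree has a finite automorphism group. For a groupoid $C$ let $\widetilde C$ be the groupoid of finite families of objects of $C$; put $\mathbf F=\widetilde{\mathbf T}$ (the $P$-forests). Let $R:\mathbf T\to I$ and $L:\mathbf T\to\widetilde I$ be the root map and the leaf map. For $v\in I$ let $\mathbf T_v$ be the homotopy fibre of $R$ over $v$, and for $N\in\widetilde I$ let ${}_N\mathbf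 T_v$ be the homotopy fibre over $N$ of the restriction of $L$ to $\mathbf T_v$, with its canonical action of $\operatorname{Aut}(N)$ and homotopy quotient ${}_N\mathbf T_v/\operatorname{Aut}(N)$. For a morphism of groupoids $X\to\mathbf T$ with finite homotopy fibres $X_T$, its relative cardinality is the power series $\sum_{T\in\pi_0\mathbf T}\frac{|X_T|}{|\operatorname{Aut}(T)|}\,\delta_T\in\mathbb Q[[\delta_T]]_{T\in\pi_0\mathbf T}$, where $|Y|=\sum_{y\in\pi_0Y}1/|\operatorname{Aut}(y)|$ for a finite groupoid $Y$. A multiindex $\mathbf n=(n_1,\dots,n_s)\in\mathbb N^s$ parametrises the family $N_{\mathbf n}$ consisting of $n_i$ copies of $v_i$ for each $i$. Define $$G_v=\sum_{T\in\pi_0(\mathbf T_v)}\frac{\delta_T}{|\operatorname{Aut}_v(T)|},\qquad G^{\mathbf n}=\prod_{i=1}^s G_{v_i}^{\,n_i},$$ where $\operatorname{Aut}_v(T)$ is the vertex group in $\mathbf T_v$, and let $g_{\mathbf n,v}$ be the relative cardinality of ${}_{N_{\mathbf n}}\mathbf T_v/\operatorname{Aut}(N_{\mathbf n})\to\mathbf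 T$. Let $\mathcal B=\mathbb Q[\delta_T]_{T\in\pi_0\mathbf T}$, with the algebra homomorphism $\Delta:\mathcal B\to\mathcal B\otimes\mathcal B$ given on generators by $$\Delta(\delta_T)=\sum_{c\in\operatorname{cut}(T)}\delta_{P_c}\otimes\delta_{S_c}.$$ Here a cut $c$ of $T$ is a subtree $S_c$ of $T$ containing the root (and, with each of its nodes, all edges incident to it), $P_c$ is the forest of the ideal subtrees of $T$ generated by the leaves of $S_c$ (the subtree generated by an edge consists of that edge and everything above it), and $\delta_F$ is, for a forest $F$, the product of the $\delta_{T'}$ over the trees $T'$ of $F$. **Theorem.** For all $v\in I$ and $\mathbf n\in\mathbb N^s$, the morphisms $\mathbf T_v\to\mathbf T$ and ${}_{N_{\mathbf n}}\mathbf T_v/\operatorname{Aut}(N_{\mathbf n})\to\mathbf T$ have finite homotopy fibres, so that $G_v$ and $g_{\mathbf n,v}$ are well defined. The comultiplication extends to power series: each pair of monomials has a non-zero coefficient in $\Delta(\delta_F)$ for only finitely many monomials $\delta_F$. For every $v\in I$, $$\Delta(G_v)=\sum_{\mathbf n\in\mathbb N^s}G^{\mathbf n}\otimes g_{\mathbf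 n,v}$$ in the completed tensor square $\mathbb Q^{\pi_0\mathbf F\times\pi_0\mathbf F}$, where for each pair of monomials only finitely many summands on the right have a non-zero coefficient. -/

import Mathlib

universe v₁ v₂ v₃ v u₁ u₂ u₃ u

namespace TreeBialgebra

open CategoryTheory

/-! ## Groupoids, homotopy fibres and cardinality

The homotopy fibre of a morphism of groupoids `p : X ⥤ B` over `b : B` is
`CostructuredArrow p b`: its objects are the pairs `(x, φ : p x ⟶ b)`, and its arrows are the arrows
of `X` compatible with the second components. -/

/-- The set `π₀ X` of isomorphism classes of objects. -/
def Pi0 (X : Type u) [Category.{v} X] : Type u := Quotient (isIsomorphicSetoid X)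

namespace Pi0

variable {X : Type u} [Category.{v} X]

/-- The isomorphism class of an object. -/
def mk (x : X) : Pi0 X := Quotient.mk (isIsomorphicSetoid X) x

/-- A chosen representative of an isomorphism class. -/
noncomputable def rep (x : Pi0 X) : X := Quotient.out x

theorem mk_rep (x : Pi0 X) : mk x.rep = x := Quotient.out_eq x

theorem mk_eq_mk_iff (x y : X) : mk x = mk y ↔ Nonempty (x ≅ y) :=
  ⟨fun h => Quotient.exact h, fun h => Quotient.sound h⟩

end Pi0

/-- A groupoid is finite if it has finitely many isomorphism classes and finite vertex groups. -/
structure IsFiniteGroupoid (X : Type u) [Category.{v} X] : Prop where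
  finite_pi0 : Finite (Pi0 X)
  finite_aut : ∀ x : X, Finite (Aut x)

/-- The cardinality `∑_{x ∈ π₀ X} 1 / |Aut x|` of a finite groupoid. -/
noncomputable def groupoidCard (X : Type u) [Category.{v} X] : ℚ :=
  ∑ᶠ x : Pi0 X, 1 / (Nat.card (Aut x.rep) : ℚ)

/-- A morphism of groupoids is finite if all its homotopy fibres are finite. -/
def IsFiniteMorphism {X : Type u₁} [Category.{v₁} X] {B : Type u₂} [Category.{v₂} B]
    (p : X ⥤ B) : Prop :=
  ∀ b : B, IsFiniteGroupoid (CostructuredArrow p b)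

/-- The relative cardinality `∑_{b ∈ π₀ B} (|X_b| / |Aut b|) δ_b` of a finite morphism
`p : X ⥤ B`, as a function on `π₀ B`. -/
noncomputable def relCard {X : Type u₁} [Category.{v₁} X] {B : Type u₂} [Category.{v₂} B]
    (p : X ⥤ B) : Pi0 B → ℚ :=
  fun b => groupoidCard (CostructuredArrow p b.rep) / (Nat.card (Aut b.rep) : ℚ)

section HomotopyQuotient

variable {X : Type u₁} [Category.{v₁} X] {B : Type u₂} [Category.{v₂} B]

/-- The homotopy quotient `X_b / Aut b` of the homotopy fibre of `p : X ⥤ B` over `b` by the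
canonical action `(x, φ) ↦ (x, φ ≫ g)` of `Aut b`. It is the Grothendieck construction of this
action: its objects are those of the fibre, and an arrow from `x` to `y` is a pair consisting of
`g : Aut b` and an arrow from the translate of `x` by `g` to `y`. -/
abbrev FibreQuotient (p : X ⥤ B) (b : B) :=
  Grothendieck (SingleObj.functor (Aut.toEnd b) ⋙ CostructuredArrow.functor p)

/-- The canonical morphism `X_b / Aut b ⥤ X`, given on objects by `(x, φ) ↦ x`. -/
abbrev FibreQuotient.proj (p : X ⥤ B) (b : B) : FibreQuotient p b ⥤ X :=
  CostructuredArrow.grothendieckPrecompFunctorToComma p (SingleObj.functor (Aut.toEnd b)) ⋙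
    Comma.fst _ _

end HomotopyQuotient

/-! ## Families of objects -/

/-- A finite family of objects of `C`. For a groupoid `I`, `Fam I` is the groupoid of `I`-coloured
finite sets. -/
structure Fam (C : Type u) where
  /-- The indexing set. -/
  ι : Type
  [finite : Finite ι]
  /-- The members of the family. -/
  obj : ι → C

namespace Fam

attribute [instance] Fam.finite

variable {C : Type u} [Category.{v} C]

/-- An arrow of families: a bijection of the indexing sets, together with arrows between
corresponding members. -/
@[ext]
structure Hom (X Y : Fam C) where
  /-- The bijection of indexing sets. -/
  e : X.ι ≃ Y.ι
  /-- The arrows between corresponding members. -/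
  φ : ∀ i, X.obj i ⟶ Y.obj (e i)

instance : Category (Fam C) where
  Hom := Hom
  id _ := ⟨Equiv.refl _, fun _ => 𝟙 _⟩
  comp f g := ⟨f.e.trans g.e, fun i => f.φ i ≫ g.φ (f.e i)⟩
  id_comp _ := Hom.ext rfl (heq_of_eq (funext fun _ => Category.id_comp _))
  comp_id _ := Hom.ext rfl (heq_of_eq (funext fun _ => Category.comp_id _))
  assoc _ _ _ := Hom.ext rfl (heq_of_eq (funext fun _ => Category.assoc _ _ _))

theorem hom_ext {X Y : Fam C} {f g : X ⟶ Y} (h : ∀ i, f.e i = g.e i)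
    (h' : ∀ i, f.φ i ≫ eqToHom (congrArg Y.obj (h i)) = g.φ i) : f = g := by
  obtain ⟨e, φ⟩ := f
  obtain ⟨e', φ'⟩ := g
  obtain rfl : e = e' := Equiv.ext h
  refine Hom.ext rfl (heq_of_eq (funext fun i => ?_))
  simpa using h' i

theorem φ_eqToHom {X Y : Fam C} (f : Hom X Y) {i j : X.ι} (h : i = j) :
    f.φ i ≫ eqToHom (congrArg (fun k => Y.obj (f.e k)) h) = eqToHom (congrArg X.obj h) ≫ f.φ j := by
  subst h; simp

/-- Families of objects of a groupoid form a groupoid. -/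
noncomputable instance {I : Type u} [Groupoid.{v} I] : Groupoid (Fam I) where
  inv {X Y} f := ⟨f.e.symm, fun j =>
    eqToHom (congrArg Y.obj (f.e.apply_symm_apply j).symm) ≫ Groupoid.inv (f.φ (f.e.symm j))⟩
  inv_comp {X Y} f := by
    refine hom_ext (fun j => f.e.apply_symm_apply j) fun j => ?_
    change ((eqToHom _ ≫ Groupoid.inv (f.φ (f.e.symm j))) ≫ f.φ (f.e.symm j)) ≫ eqToHom _ = 𝟙 _
    simp only [Category.assoc, Groupoid.inv_eq_inv, IsIso.inv_hom_id_assoc]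
    exact (eqToHom_trans _ _).trans (eqToHom_refl _ _)
  comp_inv {X Y} f := by
    refine hom_ext (fun i => f.e.symm_apply_apply i) fun i => ?_
    change (f.φ i ≫ eqToHom _ ≫ Groupoid.inv (f.φ (f.e.symm (f.e i)))) ≫ eqToHom _ = 𝟙 _
    have h := φ_eqToHom f (f.e.symm_apply_apply i)
    have h2 : f.φ i = eqToHom (congrArg X.obj (f.e.symm_apply_apply i)).symm ≫
        f.φ (f.e.symm (f.e i)) ≫
          eqToHom (congrArg (fun k => Y.obj (f.e k)) (f.e.symm_apply_apply i)) := by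
      rw [h]; simp
    rw [h2]
    simp only [Category.assoc, eqToHom_trans_assoc, eqToHom_refl, Category.id_comp,
      Groupoid.inv_eq_inv, IsIso.hom_inv_id_assoc]
    exact (eqToHom_trans _ _).trans (eqToHom_refl _ _)

end Fam

/-! ## Trees -/

open Classical in
/-- The walk-to-the-root function of a diagram `A ← M → N → A`: an edge `s m` is sent to
`t (p m)`, and an edge outside the image of `s` is fixed. -/
noncomputable def walkToRoot {A M N : Type} (s : M → A) (p : M → N) (t : N → A) (a : A) : A :=
  if h : ∃ m, s m = a then t (p h.choose) else a

theorem walkToRoot_of_eq {A M N : Type} {s : M → A} (hs : Function.Injective s) (p : M → N)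
    (t : N → A) (m : M) : walkToRoot s p t (s m) = t (p m) := by
  have h : ∃ m', s m' = s m := ⟨m, rfl⟩
  rw [walkToRoot, dif_pos h, hs h.choose_spec]

theorem walkToRoot_of_not {A M N : Type} {s : M → A} (p : M → N) (t : N → A) {a : A}
    (h : ¬ ∃ m, s m = a) : walkToRoot s p t a = a := by
  rw [walkToRoot, dif_neg h]

/-- An (operadic) tree: a diagram of finite sets `A ← M → N → A` with maps `s`, `p`, `t`, where `A`
is the set of edges, `N` the set of nodes, and `M` the set of nodes with a marked input edge. -/
structure OpTree where
  /-- Edges. -/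
  A : Type
  /-- Nodes with a marked input edge. -/
  M : Type
  /-- Nodes. -/
  N : Type
  [finite_A : Finite A]
  [finite_M : Finite M]
  [finite_N : Finite N]
  /-- The marked edge. -/
  s : M → A
  /-- Forget the marked edge. -/
  p : M → N
  /-- The output edge of a node. -/
  t : N → A
  /-- The root edge. -/
  root : A
  t_injective : Function.Injective t
  s_injective : Function.Injective s
  exists_s_eq_iff : ∀ a, (∃ m, s m = a) ↔ a ≠ root
  walk : ∀ a, ∃ k : ℕ, (walkToRoot s p t)^[k] a = root

attribute [instance] OpTree.finite_A OpTree.finite_M OpTree.finite_N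

namespace OpTree

/-- The walk-to-the-root function of a tree. -/
noncomputable def σ (T : OpTree) : T.A → T.A := walkToRoot T.s T.p T.t

theorem σ_s (T : OpTree) (m : T.M) : T.σ (T.s m) = T.t (T.p m) :=
  walkToRoot_of_eq T.s_injective _ _ _

theorem σ_root (T : OpTree) : T.σ T.root = T.root :=
  walkToRoot_of_not _ _ fun h => (T.exists_s_eq_iff _).1 h rfl

/-- The leaves of a tree: the edges that are not the output edge of a node. -/
def Leaf (T : OpTree) : Type := {a : T.A // ¬ ∃ n, T.t n = a}

instance (T : OpTree) : Finite T.Leaf := inferInstanceAs (Finite {a : T.A // ¬ ∃ n, T.t n = a})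

/-- A subtree: a set of edges and a set of nodes, containing the output edge and all the input
edges of each of its nodes, such that exactly one of its edges (its root) is not an input edge of
one of its nodes. The nodes with a marked input edge of the subtree are those of `T` whose node
is in the subtree; thus the embedding is arity preserving. -/
@[ext]
structure Subtree (T : OpTree) where
  /-- The edges of the subtree. -/
  edges : Set T.A
  /-- The nodes of the subtree. -/
  nodes : Set T.N
  /-- The root of the subtree. -/
  root : T.A
  root_mem : root ∈ edges
  t_mem : ∀ n ∈ nodes, T.t n ∈ edges
  s_mem : ∀ m, T.p m ∈ nodes → T.s m ∈ edges
  exists_s_eq_iff : ∀ a ∈ edges, (∃ m, T.p m ∈ nodes ∧ T.s m = a) ↔ a ≠ root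

namespace Subtree

variable {T : OpTree} (S : Subtree T)

/-- The walk from any edge of a subtree reaches the root of the subtree. -/
theorem exists_iterate (a : T.A) (ha : a ∈ S.edges) : ∃ k : ℕ,
    (walkToRoot (A := S.edges) (M := {m : T.M // T.p m ∈ S.nodes}) (N := S.nodes)
      (fun m => ⟨T.s m.1, S.s_mem _ m.2⟩) (fun m => ⟨T.p m.1, m.2⟩)
      (fun n => ⟨T.t n.1, S.t_mem _ n.2⟩))^[k] ⟨a, ha⟩ = ⟨S.root, S.root_mem⟩ := by
  obtain ⟨k, hk⟩ := T.walk a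
  induction k generalizing a with
  | zero =>
    have h : a = T.root := hk
    refine ⟨0, Subtype.ext ?_⟩
    by_contra hne
    obtain ⟨m, -, hm⟩ := (S.exists_s_eq_iff a ha).2 hne
    exact (T.exists_s_eq_iff a).1 ⟨m, hm⟩ h
  | succ k ih =>
    by_cases hne : a = S.root
    · exact ⟨0, Subtype.ext hne⟩
    · obtain ⟨m, hm, rfl⟩ := (S.exists_s_eq_iff a ha).2 hne
      rw [Function.iterate_succ_apply, walkToRoot_of_eq T.s_injective] at hk
      obtain ⟨j, hj⟩ := ih (T.t (T.p m)) (S.t_mem _ hm) hk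
      refine ⟨j + 1, ?_⟩
      rw [Function.iterate_succ_apply]
      have := walkToRoot_of_eq (A := S.edges) (M := {m : T.M // T.p m ∈ S.nodes}) (N := S.nodes)
        (s := fun m => ⟨T.s m.1, S.s_mem _ m.2⟩)
        (fun x y h => Subtype.ext (T.s_injective (congrArg Subtype.val h)))
        (fun m => ⟨T.p m.1, m.2⟩) (fun n => ⟨T.t n.1, S.t_mem _ n.2⟩) ⟨m, hm⟩
      exact (congrArg _ this).trans hj

/-- A subtree, as a tree. -/
def toTree : OpTree where
  A := S.edges
  M := {m : T.M // T.p m ∈ S.nodes}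
  N := S.nodes
  s m := ⟨T.s m.1, S.s_mem _ m.2⟩
  p m := ⟨T.p m.1, m.2⟩
  t n := ⟨T.t n.1, S.t_mem _ n.2⟩
  root := ⟨S.root, S.root_mem⟩
  t_injective x y h := Subtype.ext (T.t_injective (congrArg Subtype.val h))
  s_injective x y h := Subtype.ext (T.s_injective (congrArg Subtype.val h))
  exists_s_eq_iff a := by
    have h := S.exists_s_eq_iff a.1 a.2
    constructor
    · rintro ⟨m, rfl⟩ h'
      exact h.1 ⟨m.1, m.2, rfl⟩ (congrArg Subtype.val h')
    · intro h'
      obtain ⟨m, hm, e⟩ := h.2 fun e => h' (Subtype.ext e)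
      exact ⟨⟨m, hm⟩, Subtype.ext e⟩
  walk a := S.exists_iterate a.1 a.2

end Subtree

/-- The ideal subtree generated by an edge `e`: the edge `e`, which becomes the root, and all the
edges and nodes above it. -/
def ideal (T : OpTree) (e : T.A) : Subtree T where
  edges := {a | ∃ k : ℕ, T.σ^[k] a = e}
  nodes := {n | ∃ k : ℕ, T.σ^[k] (T.t n) = e}
  root := e
  root_mem := ⟨0, rfl⟩
  t_mem n h := h
  s_mem := by
    rintro m ⟨k, hk⟩
    exact ⟨k + 1, by rw [Function.iterate_succ_apply, T.σ_s, hk]⟩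
  exists_s_eq_iff := by
    rintro a ⟨k, hk⟩
    constructor
    · rintro ⟨m, ⟨j, hj⟩, rfl⟩ h
      have hper : T.σ^[j + 1] e = e := by
        rw [← h, Function.iterate_succ_apply, T.σ_s, hj, h]
      have hper' : ∀ i, T.σ^[(j + 1) * i] e = e := fun i => by
        rw [Function.iterate_mul]; exact Function.iterate_fixed hper i
      obtain ⟨l, hl⟩ := T.walk e
      have hroot : ∀ i, T.σ^[i] T.root = T.root := fun i => Function.iterate_fixed T.σ_root i
      have he : e = T.root := by
        have h1 := hper' l
        have h2 : (j + 1) * l = j * l + l := by ring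
        rw [h2, Function.iterate_add_apply] at h1
        change T.σ^[j * l] ((walkToRoot T.s T.p T.t)^[l] e) = e at h1
        rw [hl, hroot] at h1
        exact h1.symm
      exact (T.exists_s_eq_iff _).1 ⟨m, rfl⟩ (h.trans he)
    · intro hne
      cases k with
      | zero => exact absurd hk hne
      | succ k =>
        by_cases hr : a = T.root
        · subst hr
          exact absurd ((Function.iterate_fixed T.σ_root (k + 1)).symm.trans hk) hne
        · obtain ⟨m, rfl⟩ := (T.exists_s_eq_iff a).2 hr
          rw [Function.iterate_succ_apply, T.σ_s] at hk
          exact ⟨m, ⟨k, hk⟩, rfl⟩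

/-- A cut of a tree: a subtree containing the root. -/
def Cut (T : OpTree) : Type := {S : Subtree T // T.root ∈ S.edges}

instance (T : OpTree) : Finite T.Cut := by
  refine Finite.of_injective
    (fun c : T.Cut => (c.1.edges, c.1.nodes, c.1.root)) fun c d h => ?_
  simp only [Prod.mk.injEq] at h
  exact Subtype.ext (Subtree.ext h.1 h.2.1 h.2.2)

end OpTree

/-! ## Decorated trees -/

/-- A diagram of groupoids `I ← E → B → I`, representing a polynomial endofunctor. -/
structure PolyDiagram (I : Type u₁) [Groupoid.{v₁} I] (E : Type u₂) [Groupoid.{v₂} E]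
    (B : Type u₃) [Groupoid.{v₃} B] where
  /-- The input colours. -/
  s : E ⥤ I
  /-- The middle map, whose homotopy fibres are the arities. -/
  p : E ⥤ B
  /-- The output colour. -/
  t : B ⥤ I

variable {I : Type u₁} [Groupoid.{v₁} I] {E : Type u₂} [Groupoid.{v₂} E]
  {B : Type u₃} [Groupoid.{v₃} B]

/-- A `P`-tree: a tree `A ← M → N → A` with maps `α : A → I`, `β : M → E`, `γ : N → B` and three
squares that commute up to specified isomorphisms, the middle square being homotopy cartesian. -/
structure PTree (P : PolyDiagram I E B) where
  /-- The underlying tree. -/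
  tree : OpTree
  /-- The decoration of the edges. -/
  α : tree.A → I
  /-- The decoration of the nodes with a marked input edge. -/
  β : tree.M → E
  /-- The decoration of the nodes. -/
  γ : tree.N → B
  /-- The left-hand square. -/
  left : ∀ m, α (tree.s m) ⟶ P.s.obj (β m)
  /-- The middle square. -/
  mid : ∀ m, P.p.obj (β m) ⟶ γ (tree.p m)
  /-- The right-hand square. -/
  right : ∀ n, P.t.obj (γ n) ⟶ α (tree.t n)
  /-- The middle square is homotopy cartesian: for each node `n`, the input edges of `n` are
  identified with the homotopy fibre of `E ⥤ B` over `γ n`. -/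
  cartesian : ∀ n : tree.N, (Discrete.functor fun m : {m : tree.M // tree.p m = n} =>
    (CostructuredArrow.mk (mid m.1 ≫ eqToHom (congrArg γ m.2)) :
      CostructuredArrow P.p (γ n))).IsEquivalence

namespace PTree

variable {P : PolyDiagram I E B}

/-- An embedding of `P`-trees: a map of diagrams whose middle square is cartesian, together with
natural isomorphisms between the decorations which are compatible with the squares. -/
@[ext]
structure Hom (T T' : PTree P) where
  /-- The map on edges. -/
  fA : T.tree.A → T'.tree.A
  /-- The map on nodes with a marked input edge. -/
  fM : T.tree.M → T'.tree.M
  /-- The map on nodes. -/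
  fN : T.tree.N → T'.tree.N
  comm_s : ∀ m, fA (T.tree.s m) = T'.tree.s (fM m)
  comm_p : ∀ m, fN (T.tree.p m) = T'.tree.p (fM m)
  comm_t : ∀ n, fA (T.tree.t n) = T'.tree.t (fN n)
  cart : ∀ n m', T'.tree.p m' = fN n → ∃! m, T.tree.p m = n ∧ fM m = m'
  /-- The isomorphisms between the decorations of the edges. -/
  φA : ∀ a, T.α a ⟶ T'.α (fA a)
  /-- The isomorphisms between the decorations of the nodes with a marked input edge. -/
  φM : ∀ m, T.β m ⟶ T'.β (fM m)
  /-- The isomorphisms between the decorations of the nodes. -/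
  φN : ∀ n, T.γ n ⟶ T'.γ (fN n)
  comm_left : ∀ m, T.left m ≫ P.s.map (φM m) =
    φA (T.tree.s m) ≫ eqToHom (congrArg T'.α (comm_s m)) ≫ T'.left (fM m)
  comm_mid : ∀ m, P.p.map (φM m) ≫ T'.mid (fM m) =
    T.mid m ≫ φN (T.tree.p m) ≫ eqToHom (congrArg T'.γ (comm_p m))
  comm_right : ∀ n, P.t.map (φN n) ≫ T'.right (fN n) =
    T.right n ≫ φA (T.tree.t n) ≫ eqToHom (congrArg T'.α (comm_t n))

theorem Hom.φA_eqToHom {T T' : PTree P} (f : Hom T T') {a b : T.tree.A} (h : a = b) :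
    eqToHom (congrArg T.α h) ≫ f.φA b = f.φA a ≫ eqToHom (congrArg (T'.α ∘ f.fA) h) := by
  subst h; simp

theorem Hom.φN_eqToHom {T T' : PTree P} (f : Hom T T') {a b : T.tree.N} (h : a = b) :
    eqToHom (congrArg T.γ h) ≫ f.φN b = f.φN a ≫ eqToHom (congrArg (T'.γ ∘ f.fN) h) := by
  subst h; simp

/-- The identity embedding. -/
def Hom.id (T : PTree P) : Hom T T where
  fA := _root_.id
  fM := _root_.id
  fN := _root_.id
  comm_s _ := rfl
  comm_p _ := rfl
  comm_t _ := rfl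
  cart n m' h := ⟨m', ⟨h, rfl⟩, fun _ h => h.2⟩
  φA _ := 𝟙 _
  φM _ := 𝟙 _
  φN _ := 𝟙 _
  comm_left m := by simp
  comm_mid m := by simp
  comm_right n := by simp

/-- Composition of embeddings. -/
def Hom.comp {T T' T'' : PTree P} (f : Hom T T') (g : Hom T' T'') : Hom T T'' where
  fA a := g.fA (f.fA a)
  fM m := g.fM (f.fM m)
  fN n := g.fN (f.fN n)
  comm_s m := by rw [f.comm_s, g.comm_s]
  comm_p m := by rw [f.comm_p, g.comm_p]
  comm_t n := by rw [f.comm_t, g.comm_t]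
  cart n m'' h := by
    obtain ⟨m', ⟨h1, h2⟩, h3⟩ := g.cart (f.fN n) m'' h
    obtain ⟨m, ⟨h4, h5⟩, h6⟩ := f.cart n m' h1
    refine ⟨m, ⟨h4, by rw [h5, h2]⟩, fun y hy => h6 y ⟨hy.1, h3 _ ⟨?_, hy.2⟩⟩⟩
    rw [← f.comm_p, hy.1]
  φA a := f.φA a ≫ g.φA (f.fA a)
  φM m := f.φM m ≫ g.φM (f.fM m)
  φN n := f.φN n ≫ g.φN (f.fN n)
  comm_left m := by
    have h := g.φA_eqToHom (f.comm_s m)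
    rw [P.s.map_comp, ← Category.assoc, f.comm_left, Category.assoc, Category.assoc, g.comm_left,
      ← Category.assoc (eqToHom _), h]
    simp
  comm_mid m := by
    have h := g.φN_eqToHom (f.comm_p m)
    rw [P.p.map_comp, Category.assoc, g.comm_mid, ← Category.assoc, f.comm_mid]
    simp only [Category.assoc]
    rw [← Category.assoc (eqToHom _), h]
    simp
  comm_right n := by
    have h := g.φA_eqToHom (f.comm_t n)
    rw [P.t.map_comp, Category.assoc, g.comm_right, ← Category.assoc, f.comm_right]
    simp only [Category.assoc]
    rw [← Category.assoc (eqToHom _), h]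
    simp

instance : Category (PTree P) where
  Hom := Hom
  id := Hom.id
  comp := Hom.comp
  id_comp f := by
    refine Hom.ext rfl rfl rfl (heq_of_eq ?_) (heq_of_eq ?_) (heq_of_eq ?_) <;>
    exact funext fun _ => Category.id_comp _
  comp_id f := by
    refine Hom.ext rfl rfl rfl (heq_of_eq ?_) (heq_of_eq ?_) (heq_of_eq ?_) <;>
    exact funext fun _ => Category.comp_id _
  assoc f g h := by
    refine Hom.ext rfl rfl rfl (heq_of_eq ?_) (heq_of_eq ?_) (heq_of_eq ?_) <;>
    exact funext fun _ => Category.assoc _ _ _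

@[simp] theorem id_fA (T : PTree P) (a : T.tree.A) : Hom.fA (𝟙 T) a = a := rfl
@[simp] theorem id_fN (T : PTree P) (n : T.tree.N) : Hom.fN (𝟙 T) n = n := rfl
@[simp] theorem id_fM (T : PTree P) (m : T.tree.M) : Hom.fM (𝟙 T) m = m := rfl
@[simp] theorem id_φA (T : PTree P) (a : T.tree.A) : Hom.φA (𝟙 T) a = 𝟙 (T.α a) := rfl
@[simp] theorem comp_fA {T T' T'' : PTree P} (f : T ⟶ T') (g : T' ⟶ T'') (a : T.tree.A) :
    (f ≫ g).fA a = g.fA (f.fA a) := rfl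
@[simp] theorem comp_fN {T T' T'' : PTree P} (f : T ⟶ T') (g : T' ⟶ T'') (n : T.tree.N) :
    (f ≫ g).fN n = g.fN (f.fN n) := rfl
@[simp] theorem comp_fM {T T' T'' : PTree P} (f : T ⟶ T') (g : T' ⟶ T'') (m : T.tree.M) :
    (f ≫ g).fM m = g.fM (f.fM m) := rfl
@[simp] theorem comp_φA {T T' T'' : PTree P} (f : T ⟶ T') (g : T' ⟶ T'') (a : T.tree.A) :
    (f ≫ g).φA a = f.φA a ≫ g.φA (f.fA a) := rfl

theorem iso_fA_hom_inv {T T' : PTree P} (f : T ≅ T') (a : T.tree.A) :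
    f.inv.fA (f.hom.fA a) = a := by
  rw [← comp_fA, f.hom_inv_id, id_fA]

theorem iso_fA_inv_hom {T T' : PTree P} (f : T ≅ T') (a : T'.tree.A) :
    f.hom.fA (f.inv.fA a) = a := by
  rw [← comp_fA, f.inv_hom_id, id_fA]

/-- Isomorphisms preserve the root. -/
theorem iso_fA_root {T T' : PTree P} (f : T ≅ T') : f.hom.fA T.tree.root = T'.tree.root := by
  by_contra h
  obtain ⟨m, hm⟩ := (T'.tree.exists_s_eq_iff _).2 h
  have h2 : T.tree.s (f.inv.fM m) = T.tree.root := by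
    rw [← f.inv.comm_s, hm, iso_fA_hom_inv]
  exact (T.tree.exists_s_eq_iff _).1 ⟨_, h2⟩ rfl

/-- Isomorphisms preserve the leaves. -/
theorem iso_leaf {T T' : PTree P} (f : T ≅ T') {a : T.tree.A} (h : ¬ ∃ n, T.tree.t n = a) :
    ¬ ∃ n, T'.tree.t n = f.hom.fA a := by
  rintro ⟨n, hn⟩
  exact h ⟨f.inv.fN n, by rw [← f.inv.comm_t, hn, iso_fA_hom_inv]⟩

/-- The bijection between the leaves induced by an isomorphism. -/
def leafEquiv {T T' : PTree P} (f : T ≅ T') : T.tree.Leaf ≃ T'.tree.Leaf where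
  toFun a := ⟨f.hom.fA a.1, iso_leaf f a.2⟩
  invFun a := ⟨f.inv.fA a.1, iso_leaf f.symm a.2⟩
  left_inv a := Subtype.ext (iso_fA_hom_inv f a.1)
  right_inv a := Subtype.ext (iso_fA_inv_hom f a.1)

/-- The restriction of the decorations of a `P`-tree to a subtree. -/
def restrict (T : PTree P) (S : T.tree.Subtree) : PTree P where
  tree := S.toTree
  α a := T.α a.1
  β m := T.β m.1
  γ n := T.γ n.1
  left m := T.left m.1
  mid m := T.mid m.1
  right n := T.right n.1
  cartesian n := by
    let e : {m : S.toTree.M // S.toTree.p m = n} ≃ {m : T.tree.M // T.tree.p m = n.1} :=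
      { toFun := fun m => ⟨m.1.1, congrArg Subtype.val m.2⟩
        invFun := fun m => ⟨⟨m.1, by rw [m.2]; exact n.2⟩, Subtype.ext m.2⟩
        left_inv := fun _ => rfl
        right_inv := fun _ => rfl }
    have := T.cartesian n.1
    exact Functor.isEquivalence_of_iso (F := (Discrete.equivalence e).functor ⋙
      (Discrete.functor fun m : {m : T.tree.M // T.tree.p m = n.1} =>
        (CostructuredArrow.mk (T.mid m.1 ≫ eqToHom (congrArg T.γ m.2)) :
          CostructuredArrow P.p (T.γ n.1))))
      (Discrete.natIso fun _ => Iso.refl _)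

end PTree

/-- The groupoid of `P`-trees and isomorphisms of `P`-trees. -/
abbrev Trees (P : PolyDiagram I E B) := Core (PTree P)

/-- The groupoid of `P`-forests, that is, of finite families of `P`-trees. -/
abbrev Forests (P : PolyDiagram I E B) := Fam (Trees P)

variable (P : PolyDiagram I E B)

/-- The root map `R`, sending a `P`-tree to the colour of its root. -/
def rootMap : Trees P ⥤ I where
  obj T := T.of.α T.of.tree.root
  map {T T'} f := f.iso.hom.φA T.of.tree.root ≫
    eqToHom (congrArg T'.of.α (PTree.iso_fA_root f.iso))
  map_id T := by
    change (𝟙 T.of : T.of ⟶ T.of).φA _ ≫ _ = _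
    simp
  map_comp {T T' T''} f g := by
    change (f.iso.hom ≫ g.iso.hom).φA _ ≫ _ = _
    have h := g.iso.hom.φA_eqToHom (PTree.iso_fA_root f.iso)
    simp only [PTree.comp_φA, Category.assoc]
    rw [← Category.assoc (eqToHom _), h]
    simp

/-- The leaf map `L`, sending a `P`-tree to the family of the colours of its leaves. -/
def leafMap : Trees P ⥤ Fam I where
  obj T := ⟨T.of.tree.Leaf, fun a => T.of.α a.1⟩
  map f := ⟨PTree.leafEquiv f.iso, fun a => f.iso.hom.φA a.1⟩
  map_id _ := rfl
  map_comp _ _ := rfl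

/-- The homotopy fibre `T_v`: `P`-trees with root colour `v`. -/
abbrev TreesOver (v : I) := CostructuredArrow (rootMap P) v

/-- The canonical morphism `T_v ⥤ T`. -/
abbrev treesOverProj (v : I) : TreesOver P v ⥤ Trees P := CostructuredArrow.proj (rootMap P) v

/-- The leaf map restricted to `T_v`. -/
abbrev leafMapOver (v : I) : TreesOver P v ⥤ Fam I := treesOverProj P v ⋙ leafMap P

/-- The canonical morphism `_N T_v / Aut N ⥤ T`, where `_N T_v` is the homotopy fibre over `N` of
the leaf map `T_v ⥤ Fam I`. -/
abbrev summandProj (N : Fam I) (v : I) : FibreQuotient (leafMapOver P v) N ⥤ Trees P :=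
  FibreQuotient.proj (leafMapOver P v) N ⋙ treesOverProj P v

/-! ## The bialgebra of trees -/

/-- The polynomial ring `ℚ[δ_T]` on the isomorphism classes of `P`-trees. -/
abbrev TreeAlg := MvPolynomial (Pi0 (Trees P)) ℚ

variable {P}

/-- The monomial `δ_F` of a forest: the product of the variables of its constituent trees. -/
noncomputable def forestMonomial (F : Forests P) : TreeAlg P :=
  ∏ᶠ i : F.ι, MvPolynomial.X (Pi0.mk (F.obj i))

/-- For a cut `c` of `T`, the tree `S_c` found below the cut. -/
def lowerTree (T : Trees P) (c : T.of.tree.Cut) : Trees P := ⟨T.of.restrict c.1⟩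

/-- For a cut `c` of `T`, the forest `P_c` of the ideal subtrees of `T` generated by the leaves
of `S_c`. -/
def upperForest (T : Trees P) (c : T.of.tree.Cut) : Forests P where
  ι := c.1.toTree.Leaf
  obj l := ⟨T.of.restrict (T.of.tree.ideal l.1.1)⟩

open scoped TensorProduct

variable (P) in
/-- The comultiplication of the bialgebra of trees: the algebra homomorphism given on generators
by `Δ(δ_T) = ∑_{c ∈ cut(T)} δ_{P_c} ⊗ δ_{S_c}`. -/
noncomputable def comul : TreeAlg P →ₐ[ℚ] TreeAlg P ⊗[ℚ] TreeAlg P :=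
  MvPolynomial.aeval fun x : Pi0 (Trees P) =>
    ∑ᶠ c : x.rep.of.tree.Cut,
      forestMonomial (upperForest x.rep c) ⊗ₜ[ℚ] MvPolynomial.X (Pi0.mk (lowerTree x.rep c))

variable (P)

/-- Monomials in the variables `δ_T`. They form a basis of the bialgebra of trees. -/
abbrev Mon := Pi0 (Trees P) →₀ ℕ

/-- The power series ring `ℚ⟦δ_T⟧`, the completion of the bialgebra of trees. -/
abbrev TreeSeries := MvPowerSeries (Pi0 (Trees P)) ℚ

/-- The completion of the tensor square of the bialgebra of trees: all families of coefficients,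
indexed by pairs of monomials. -/
abbrev TensorSeries := Mon P × Mon P → ℚ

variable {P}

/-- The coefficient of an element of the tensor square at a pair of monomials. -/
noncomputable def tensorCoeff (d : Mon P × Mon P) : TreeAlg P ⊗[ℚ] TreeAlg P →ₗ[ℚ] ℚ :=
  LinearMap.mul' ℚ ℚ ∘ₗ
    TensorProduct.map (MvPolynomial.lcoeff ℚ d.1) (MvPolynomial.lcoeff ℚ d.2)

/-- The tensor product of two power series. -/
noncomputable def tensorSeries (f g : TreeSeries P) : TensorSeries P :=
  fun d => MvPowerSeries.coeff d.1 f * MvPowerSeries.coeff d.2 g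

variable (P) in
/-- The comultiplication extends to power series: for every pair `d` of monomials, only finitely
many monomials have a coproduct with a non-zero coefficient at `d`. -/
def ComulExtends : Prop :=
  ∀ d : Mon P × Mon P,
    {m : Mon P | tensorCoeff d (comul P (MvPolynomial.monomial m 1)) ≠ 0}.Finite

/-- The extension of the comultiplication to power series,
`Δ(∑_m f_m δ^m) = ∑_m f_m Δ(δ^m)`. -/
noncomputable def comulSeries (f : TreeSeries P) : TensorSeries P :=
  fun d => ∑ᶠ m : Mon P,
    MvPowerSeries.coeff m f * tensorCoeff d (comul P (MvPolynomial.monomial m 1))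

open Classical in
/-- The power series `∑_T a_T δ_T`. -/
noncomputable def linearSeries (a : Pi0 (Trees P) → ℚ) : TreeSeries P :=
  fun m => ∑ᶠ x : Pi0 (Trees P), if m = Finsupp.single x 1 then a x else 0

/-! ## Green functions -/

variable (P)

open Classical in
/-- The Green function `G_v = ∑_{T ∈ π₀(T_v)} δ_T / |Aut_v(T)|` of a root colour `v`, where
`Aut_v(T)` is the vertex group of `T` in the homotopy fibre `T_v`. -/
noncomputable def green (v : I) : TreeSeries P :=
  linearSeries fun x => ∑ᶠ y : Pi0 (TreesOver P v),
    if Pi0.mk ((treesOverProj P v).obj y.rep) = x then 1 / (Nat.card (Aut y.rep) : ℚ) else 0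

variable {s : ℕ}

/-- The object `N = ∑ᵢ nᵢ ⌜vᵢ⌝` of `Fam I` parametrised by a multiindex. -/
def profile (col : Fin s → I) (n : Fin s → ℕ) : Fam I where
  ι := Σ i : Fin s, Fin (n i)
  obj x := col x.1

/-- The summand `g_{n,v}`: the relative cardinality of `_N T_v / Aut N` over the groupoid
of trees. -/
noncomputable def greenSummand (col : Fin s → I) (n : Fin s → ℕ) (v : I) : TreeSeries P :=
  linearSeries (relCard (summandProj P (profile col n) v))

/-- The power `G^n = ∏ᵢ G_{vᵢ} ^ nᵢ`. -/
noncomputable def greenPow (col : Fin s → I) (n : Fin s → ℕ) : TreeSeries P :=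
  ∏ i, green P (col i) ^ n i

end TreeBialgebra

namespace TreeBialgebra

open CategoryTheory

/-! ### Embeddings of `P`-trees: injectivity, lifting and images -/

namespace OpTree

variable (T : OpTree)

theorem iterate_σ_root (k : ℕ) : T.σ^[k] T.root = T.root := Function.iterate_fixed T.σ_root k

theorem s_ne_root (m : T.M) : T.s m ≠ T.root := (T.exists_s_eq_iff _).1 ⟨m, rfl⟩

/-- The root is the only edge lying strictly below itself. -/
theorem eq_root_of_iterate_σ_eq {a : T.A} {j : ℕ} (h : T.σ^[j + 1] a = a) : a = T.root := by
  obtain ⟨l, hl⟩ := T.walk a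
  have h1 : T.σ^[(j + 1) * l] a = a := by
    rw [Function.iterate_mul]; exact Function.iterate_fixed h l
  have h2 : (j + 1) * l = j * l + l := by ring
  rw [h2, Function.iterate_add_apply] at h1
  change T.σ^[j * l] ((walkToRoot T.s T.p T.t)^[l] a) = a at h1
  rw [hl, T.iterate_σ_root] at h1
  exact h1.symm

end OpTree

variable {I : Type u₁} [Groupoid.{v₁} I] {E : Type u₂} [Groupoid.{v₂} E]
  {B : Type u₃} [Groupoid.{v₃} B] {P : PolyDiagram I E B}

namespace PTree

theorem hom_ext {X T : PTree P} {f g : X ⟶ T} (hA : ∀ a, f.fA a = g.fA a)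
    (hM : ∀ m, f.fM m = g.fM m) (hN : ∀ n, f.fN n = g.fN n)
    (hφA : ∀ a, f.φA a ≫ eqToHom (congrArg T.α (hA a)) = g.φA a)
    (hφM : ∀ m, f.φM m ≫ eqToHom (congrArg T.β (hM m)) = g.φM m)
    (hφN : ∀ n, f.φN n ≫ eqToHom (congrArg T.γ (hN n)) = g.φN n) : f = g := by
  obtain ⟨fA, fM, fN, _, _, _, _, φA, φM, φN, _, _, _⟩ := f
  obtain ⟨gA, gM, gN, _, _, _, _, ψA, ψM, ψN, _, _, _⟩ := g
  obtain rfl : fA = gA := funext hA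
  obtain rfl : fM = gM := funext hM
  obtain rfl : fN = gN := funext hN
  refine Hom.ext rfl rfl rfl (heq_of_eq (funext fun a => ?_)) (heq_of_eq (funext fun a => ?_))
    (heq_of_eq (funext fun a => ?_))
  · simpa using hφA a
  · simpa using hφM a
  · simpa using hφN a

@[simp] theorem comp_φM {T T' T'' : PTree P} (f : T ⟶ T') (g : T' ⟶ T'') (m : T.tree.M) :
    (f ≫ g).φM m = f.φM m ≫ g.φM (f.fM m) := rfl
@[simp] theorem comp_φN {T T' T'' : PTree P} (f : T ⟶ T') (g : T' ⟶ T'') (n : T.tree.N) :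
    (f ≫ g).φN n = f.φN n ≫ g.φN (f.fN n) := rfl

section Injective

variable {X T : PTree P}

/-- The root is excluded because it is fixed in `X`, whereas its image may be an inner edge of `T`.
-/
theorem Hom.σ_fA (f : Hom X T) {a : X.tree.A} (ha : a ≠ X.tree.root) :
    T.tree.σ (f.fA a) = f.fA (X.tree.σ a) := by
  obtain ⟨m, rfl⟩ := (X.tree.exists_s_eq_iff a).2 ha
  rw [f.comm_s, T.tree.σ_s, X.tree.σ_s, f.comm_t, f.comm_p]

/-- Otherwise the walk from `a` to the root of `X` would map to a walk of positive length from `f.fA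
a` to itself. Only the root of `T` admits one, while `f.fA a` is an input edge. -/
theorem Hom.eq_root_of_fA_eq (f : Hom X T) {a : X.tree.A} (h : f.fA a = f.fA X.tree.root) :
    a = X.tree.root := by
  have key : ∀ (k : ℕ) (a : X.tree.A), X.tree.σ^[k] a = X.tree.root → a ≠ X.tree.root →
      ∃ j, T.tree.σ^[j + 1] (f.fA a) = f.fA X.tree.root := by
    intro k
    induction k with
    | zero => exact fun a h h' => absurd h h'
    | succ k ih =>
      intro a h h'
      by_cases h2 : X.tree.σ a = X.tree.root
      · exact ⟨0, by simp only [zero_add, Function.iterate_one]; rw [f.σ_fA h', h2]⟩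
      · obtain ⟨j, hj⟩ := ih _ h h2
        exact ⟨j + 1, by rw [Function.iterate_succ_apply, f.σ_fA h', hj]⟩
  by_contra hne
  obtain ⟨k, hk⟩ := X.tree.walk a
  obtain ⟨j, hj⟩ := key k a hk hne
  rw [← h] at hj
  obtain ⟨m, rfl⟩ := (X.tree.exists_s_eq_iff a).2 hne
  have := T.tree.eq_root_of_iterate_σ_eq hj
  rw [f.comm_s] at this
  exact T.tree.s_ne_root _ this

theorem Hom.M_eq (f : Hom X T) {m m' : X.tree.M} (h : f.fM m = f.fM m')
    (hp : X.tree.p m = X.tree.p m') : m = m' := by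
  obtain ⟨_, _, h3⟩ := f.cart (X.tree.p m) (f.fM m) (f.comm_p m).symm
  exact (h3 m ⟨rfl, rfl⟩).trans (h3 m' ⟨hp.symm, h.symm⟩).symm

/-- Induction on the distance to the root: if two input edges have the same image, so do the output
edges of their nodes. These coincide by induction, hence the nodes do, and cartesianness separates
the inputs of one node. -/
theorem Hom.fA_injective (f : Hom X T) : Function.Injective f.fA := by
  have key : ∀ (k : ℕ) (a b : X.tree.A), X.tree.σ^[k] a = X.tree.root → f.fA a = f.fA b →
      a = b := by
    intro k
    induction k with
    | zero =>
      rintro a b h h'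
      obtain rfl : a = X.tree.root := h
      exact (f.eq_root_of_fA_eq h'.symm).symm
    | succ k ih =>
      intro a b h h'
      by_cases ha : a = X.tree.root
      · subst ha
        exact (f.eq_root_of_fA_eq h'.symm).symm
      by_cases hb : b = X.tree.root
      · subst hb
        exact f.eq_root_of_fA_eq h'
      obtain ⟨m, rfl⟩ := (X.tree.exists_s_eq_iff a).2 ha
      obtain ⟨m', rfl⟩ := (X.tree.exists_s_eq_iff b).2 hb
      rw [Function.iterate_succ_apply, X.tree.σ_s] at h
      rw [f.comm_s, f.comm_s] at h'
      have h1 := T.tree.s_injective h'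
      have h2 : f.fA (X.tree.t (X.tree.p m)) = f.fA (X.tree.t (X.tree.p m')) := by
        rw [f.comm_t, f.comm_t, f.comm_p, f.comm_p, h1]
      rw [f.M_eq h1 (X.tree.t_injective (ih _ _ h h2))]
  intro a b h
  obtain ⟨k, hk⟩ := X.tree.walk a
  exact key k a b hk h

theorem Hom.fN_injective (f : Hom X T) : Function.Injective f.fN := fun n n' h =>
  X.tree.t_injective (f.fA_injective (by rw [f.comm_t, f.comm_t, h]))

theorem Hom.fM_injective (f : Hom X T) : Function.Injective f.fM := fun n n' h =>
  X.tree.s_injective (f.fA_injective (by rw [f.comm_s, f.comm_s, h]))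

end Injective

theorem φA_congr {X T : PTree P} {f g : X ⟶ T} (h : f = g) (a : X.tree.A) :
    f.φA a ≫ eqToHom (congrArg (fun k : X ⟶ T => T.α (k.fA a)) h) = g.φA a := by
  subst h; simp

theorem φM_congr {X T : PTree P} {f g : X ⟶ T} (h : f = g) (a : X.tree.M) :
    f.φM a ≫ eqToHom (congrArg (fun k : X ⟶ T => T.β (k.fM a)) h) = g.φM a := by
  subst h; simp

theorem φN_congr {X T : PTree P} {f g : X ⟶ T} (h : f = g) (a : X.tree.N) :
    f.φN a ≫ eqToHom (congrArg (fun k : X ⟶ T => T.γ (k.fN a)) h) = g.φN a := by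
  subst h; simp

theorem Hom.φM_eqToHom {T T' : PTree P} (f : Hom T T') {a b : T.tree.M} (h : a = b) :
    eqToHom (congrArg T.β h) ≫ f.φM b = f.φM a ≫ eqToHom (congrArg (T'.β ∘ f.fM) h) := by
  subst h; simp

/-- Embeddings of trees are monomorphisms. -/
instance {X T : PTree P} (f : X ⟶ T) : Mono f where
  right_cancellation {Y} g h e := by
    have hA : ∀ a, g.fA a = h.fA a := fun a =>
      f.fA_injective (congrArg (fun k : Y ⟶ T => k.fA a) e)
    have hM : ∀ a, g.fM a = h.fM a := fun a =>
      f.fM_injective (congrArg (fun k : Y ⟶ T => k.fM a) e)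
    have hN : ∀ a, g.fN a = h.fN a := fun a =>
      f.fN_injective (congrArg (fun k : Y ⟶ T => k.fN a) e)
    refine hom_ext hA hM hN (fun a => ?_) (fun a => ?_) (fun a => ?_)
    · rw [← cancel_mono (f.φA (h.fA a)), Category.assoc, f.φA_eqToHom (hA a)]
      simpa using φA_congr e a
    · rw [← cancel_mono (f.φM (h.fM a)), Category.assoc, f.φM_eqToHom (hM a)]
      simpa using φM_congr e a
    · rw [← cancel_mono (f.φN (h.fN a)), Category.assoc, f.φN_eqToHom (hN a)]
      simpa using φN_congr e a

/-- A map of diagrams through which an embedding factors lifts to an embedding. -/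
theorem exists_lift {X Y T : PTree P} (f : X ⟶ T) (h : Y ⟶ T) (kA : Y.tree.A → X.tree.A)
    (kM : Y.tree.M → X.tree.M) (kN : Y.tree.N → X.tree.N) (hA : h.fA = f.fA ∘ kA)
    (hM : h.fM = f.fM ∘ kM) (hN : h.fN = f.fN ∘ kN) : ∃ k : Y ⟶ X, k ≫ f = h := by
  obtain ⟨gA, gM, gN, comm_s, comm_p, comm_t, cart, φA, φM, φN, comm_left, comm_mid,
    comm_right⟩ := h
  dsimp only at hA hM hN
  subst hA hM hN
  have hs : ∀ m, kA (Y.tree.s m) = X.tree.s (kM m) := fun m =>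
    f.fA_injective ((comm_s m).trans (f.comm_s _).symm)
  have hp : ∀ m, kN (Y.tree.p m) = X.tree.p (kM m) := fun m =>
    f.fN_injective ((comm_p m).trans (f.comm_p _).symm)
  have ht : ∀ m, kA (Y.tree.t m) = X.tree.t (kN m) := fun m =>
    f.fA_injective ((comm_t m).trans (f.comm_t _).symm)
  -- The decorations are forced by `k ≫ f = h`, as those of `f` are invertible; each square is
  -- checked after cancelling a decoration of `f`.
  refine ⟨⟨kA, kM, kN, hs, hp, ht, ?_, fun a => φA a ≫ inv (f.φA (kA a)),
    fun m => φM m ≫ inv (f.φM (kM m)), fun n => φN n ≫ inv (f.φN (kN n)), ?_, ?_, ?_⟩, ?_⟩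
  · intro n m' h
    obtain ⟨m, ⟨h1, h2⟩, h3⟩ := cart n (f.fM m') (by rw [← f.comm_p, h]; rfl)
    exact ⟨m, ⟨h1, f.fM_injective h2⟩, fun y hy => h3 y ⟨hy.1, congrArg f.fM hy.2⟩⟩
  · intro m
    have h1 := comm_left m
    have h2 := f.comm_left (kM m)
    have h3 := f.φA_eqToHom (hs m)
    rw [← cancel_mono (P.s.map (f.φM (kM m)))]
    simp only [Functor.map_comp, Functor.map_inv, Category.assoc, IsIso.inv_hom_id,
      Category.comp_id, h2]
    rw [reassoc_of% h3]
    simpa using h1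
  · intro m
    have h1 := comm_mid m
    have h2 := f.comm_mid (kM m)
    have h3 := f.φN_eqToHom (hp m)
    have h4 : X.mid (kM m) = P.p.map (f.φM (kM m)) ≫ T.mid (f.fM (kM m)) ≫
        eqToHom (congrArg T.γ (f.comm_p (kM m)).symm) ≫ inv (f.φN (X.tree.p (kM m))) := by
      rw [reassoc_of% h2]; simp
    rw [← cancel_mono (f.φN (X.tree.p (kM m)))]
    simp only [Category.assoc]
    rw [h3, h4]
    simp only [Functor.map_comp, Functor.map_inv, Category.assoc, IsIso.inv_hom_id,
      Category.comp_id, IsIso.inv_hom_id_assoc, Function.comp_apply] at h1 ⊢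
    rw [reassoc_of% h1]
    simp
  · intro m
    have h1 := comm_right m
    have h2 := f.comm_right (kN m)
    have h3 := f.φA_eqToHom (ht m)
    have h4 : X.right (kN m) = P.t.map (f.φN (kN m)) ≫ T.right (f.fN (kN m)) ≫
        eqToHom (congrArg T.α (f.comm_t (kN m)).symm) ≫ inv (f.φA (X.tree.t (kN m))) := by
      rw [reassoc_of% h2]; simp
    rw [← cancel_mono (f.φA (X.tree.t (kN m)))]
    simp only [Category.assoc]
    rw [h3, h4]
    simp only [Functor.map_comp, Functor.map_inv, Category.assoc, IsIso.inv_hom_id,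
      Category.comp_id, IsIso.inv_hom_id_assoc, Function.comp_apply] at h1 ⊢
    rw [reassoc_of% h1]
    simp
  · refine Hom.ext rfl rfl rfl (heq_of_eq (funext fun a => ?_)) (heq_of_eq (funext fun a => ?_))
      (heq_of_eq (funext fun a => ?_))
    · exact (Category.assoc _ _ _).trans (by simp)
    · exact (Category.assoc _ _ _).trans (by simp)
    · exact (Category.assoc _ _ _).trans (by simp)

theorem Hom.fM_surjective {X T : PTree P} (f : Hom X T) (h : Function.Surjective f.fN) :
    Function.Surjective f.fM := fun m' => by
  obtain ⟨n, hn⟩ := h (T.tree.p m')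
  obtain ⟨m, ⟨_, hm⟩, _⟩ := f.cart n m' hn.symm
  exact ⟨m, hm⟩

theorem Hom.fA_surjective {X T : PTree P} (f : Hom X T) (h : Function.Surjective f.fN)
    (hr : f.fA X.tree.root = T.tree.root) : Function.Surjective f.fA := fun a => by
  by_cases ha : a = T.tree.root
  · exact ⟨_, hr.trans ha.symm⟩
  · obtain ⟨m', rfl⟩ := (T.tree.exists_s_eq_iff a).2 ha
    obtain ⟨m, rfl⟩ := f.fM_surjective h m'
    exact ⟨_, f.comm_s m⟩

/-- An embedding which preserves the root and is surjective on nodes is an isomorphism. -/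
theorem isIso_of_surjective {X T : PTree P} (f : X ⟶ T) (h : Function.Surjective f.fN)
    (hr : f.fA X.tree.root = T.tree.root) : IsIso f := by
  have hA := f.fA_surjective h hr
  have hM := f.fM_surjective h
  obtain ⟨k, hk⟩ := exists_lift f (𝟙 T) (Function.surjInv hA) (Function.surjInv hM)
    (Function.surjInv h) (funext fun a => (Function.surjInv_eq hA a).symm)
    (funext fun a => (Function.surjInv_eq hM a).symm)
    (funext fun a => (Function.surjInv_eq h a).symm)
  exact ⟨k, by rw [← cancel_mono f, Category.assoc, hk]; simp, hk⟩

/-- The image of an embedding. -/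
def image {X T : PTree P} (f : X ⟶ T) : T.tree.Subtree where
  edges := Set.range f.fA
  nodes := Set.range f.fN
  root := f.fA X.tree.root
  root_mem := ⟨_, rfl⟩
  t_mem := by
    rintro _ ⟨n, rfl⟩
    exact ⟨_, f.comm_t n⟩
  s_mem := by
    rintro m' ⟨n, hn⟩
    obtain ⟨m, ⟨_, rfl⟩, _⟩ := f.cart n m' hn.symm
    exact ⟨_, f.comm_s m⟩
  exists_s_eq_iff := by
    rintro _ ⟨a, rfl⟩
    constructor
    · rintro ⟨m', ⟨n, hn⟩, h⟩ h'
      obtain ⟨m, ⟨_, rfl⟩, _⟩ := f.cart n m' hn.symm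
      rw [← f.comm_s, h'] at h
      exact X.tree.s_ne_root m (f.fA_injective h)
    · intro h
      obtain ⟨m, rfl⟩ := (X.tree.exists_s_eq_iff a).2 fun e => h (congrArg _ e)
      exact ⟨f.fM m, ⟨_, f.comm_p m⟩, (f.comm_s m).symm⟩

/-- The inclusion of a subtree. -/
def incl (T : PTree P) (U : T.tree.Subtree) : T.restrict U ⟶ T where
  fA := Subtype.val
  fM := Subtype.val
  fN := Subtype.val
  comm_s _ := rfl
  comm_p _ := rfl
  comm_t _ := rfl
  cart n m' h := ⟨⟨m', by rw [h]; exact n.2⟩, ⟨Subtype.ext h, rfl⟩, fun _ hy => Subtype.ext hy.2⟩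
  φA _ := 𝟙 _
  φM _ := 𝟙 _
  φN _ := 𝟙 _
  comm_left m := ((congrArg (T.left m.1 ≫ ·) (P.s.map_id _)).trans (Category.comp_id _)).trans
    ((Category.id_comp _).trans (Category.id_comp _)).symm
  comm_mid m := ((congrArg (· ≫ T.mid m.1) (P.p.map_id _)).trans (Category.id_comp _)).trans
    ((congrArg (T.mid m.1 ≫ ·) (Category.id_comp _)).trans (Category.comp_id _)).symm
  comm_right n := ((congrArg (· ≫ T.right n.1) (P.t.map_id _)).trans (Category.id_comp _)).trans
    ((congrArg (T.right n.1 ≫ ·) (Category.id_comp _)).trans (Category.comp_id _)).symm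

theorem image_iso_comp {X Y T : PTree P} (g : X ≅ Y) (f : Y ⟶ T) :
    image (g.hom ≫ f) = image f := by
  refine OpTree.Subtree.ext ?_ ?_ ?_
  · refine Set.ext fun a => ⟨?_, ?_⟩
    · rintro ⟨x, rfl⟩; exact ⟨_, rfl⟩
    · rintro ⟨x, rfl⟩
      exact ⟨g.inv.fA x, congrArg f.fA (iso_fA_inv_hom g x)⟩
  · refine Set.ext fun a => ⟨?_, ?_⟩
    · rintro ⟨x, rfl⟩; exact ⟨_, rfl⟩
    · rintro ⟨x, rfl⟩
      refine ⟨g.inv.fN x, congrArg f.fN ?_⟩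
      rw [← comp_fN, g.inv_hom_id, id_fN]
  · exact congrArg f.fA (iso_fA_root g)

theorem image_incl (T : PTree P) (U : T.tree.Subtree) : image (T.incl U) = U :=
  OpTree.Subtree.ext Subtype.range_val Subtype.range_val rfl

/-- Embeddings with a given image are isomorphisms onto this image. -/
noncomputable def imageEquiv (X T : PTree P) (U : T.tree.Subtree) :
    (X ≅ T.restrict U) ≃ {f : X ⟶ T // image f = U} :=
  Equiv.ofBijective
    (fun g => ⟨g.hom ≫ T.incl U, (image_iso_comp g _).trans (image_incl T U)⟩) <| by
    constructor
    · intro g h e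
      exact Iso.ext ((cancel_mono _).1 (congrArg Subtype.val e))
    · rintro ⟨f, rfl⟩
      obtain ⟨k, hk⟩ := exists_lift (T.incl (image f)) f (fun a => ⟨f.fA a, a, rfl⟩)
        (fun m => ⟨f.fM m, ⟨_, f.comm_p m⟩⟩) (fun n => ⟨f.fN n, n, rfl⟩) rfl rfl rfl
      have hA : ∀ a, (k.fA a).1 = f.fA a := fun a => congrArg (fun h : X ⟶ T => h.fA a) hk
      have hN : ∀ a, (k.fN a).1 = f.fN a := fun a => congrArg (fun h : X ⟶ T => h.fN a) hk
      -- The corestriction of `f` to its image hits every node and the root by construction.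
      have : IsIso k := isIso_of_surjective k
        (by rintro ⟨_, n, rfl⟩; exact ⟨n, Subtype.ext (hN n)⟩) (Subtype.ext (hA _))
      exact ⟨asIso k, Subtype.ext hk⟩

end PTree

end TreeBialgebra

/-! ### Grafting of trees onto leaves, and covering a tree by a cut and the ideals above it -/

namespace TreeBialgebra

open CategoryTheory

namespace OpTree

section Graft

variable (S : OpTree) (X : S.Leaf → OpTree)

/-- The edges of the grafting of a family of trees onto the leaves of a tree. -/
abbrev GraftEdge : Type := S.A ⊕ Σ l : S.Leaf, {a : (X l).A // a ≠ (X l).root}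

variable {S}

open Classical in
/-- The inclusion of the edges of a grafted tree; the root is identified with a leaf of `S`. -/
noncomputable def graftEdge (l : S.Leaf) (a : (X l).A) : S.GraftEdge X :=
  if h : a = (X l).root then .inl l.1 else .inr ⟨l, a, h⟩

variable {X}

theorem graftEdge_root (l : S.Leaf) : graftEdge X l (X l).root = .inl l.1 := dif_pos rfl

theorem graftEdge_of_ne {l : S.Leaf} {a : (X l).A} (h : a ≠ (X l).root) :
    graftEdge X l a = .inr ⟨l, a, h⟩ := dif_neg h

theorem graftEdge_eq_inl {l : S.Leaf} {a : (X l).A} {b : S.A}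
    (h : graftEdge X l a = .inl b) : a = (X l).root ∧ l.1 = b := by
  by_cases ha : a = (X l).root
  · subst ha
    rw [graftEdge_root] at h
    exact ⟨rfl, Sum.inl_injective h⟩
  · rw [graftEdge_of_ne ha] at h
    cases h

/-- Roots go to distinct leaves of `S`, and all other edges to a disjoint union, so the upper trees
do not overlap. -/
theorem sigma_eq_of_graftEdge_eq {l l' : S.Leaf} {a : (X l).A} {a' : (X l').A}
    (h : graftEdge X l a = graftEdge X l' a') : (⟨l, a⟩ : Σ l, (X l).A) = ⟨l', a'⟩ := by
  by_cases ha : a = (X l).root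
  · subst ha
    rw [graftEdge_root] at h
    obtain ⟨rfl, h2⟩ := graftEdge_eq_inl h.symm
    obtain rfl : l' = l := Subtype.ext h2
    rfl
  · by_cases ha' : a' = (X l').root
    · subst ha'
      rw [graftEdge_root] at h
      exact absurd (graftEdge_eq_inl h).1 ha
    · rw [graftEdge_of_ne ha, graftEdge_of_ne ha'] at h
      have h2 := Sum.inr_injective h
      obtain ⟨rfl, h3⟩ := Sigma.mk.inj_iff.1 h2
      rw [heq_iff_eq, Subtype.mk.injEq] at h3
      subst h3
      rfl

/-- Lets later arguments treat an upper tree as a whole, root included, at the price of counting the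
leaves of `S` twice. -/
theorem graftEdge_cases (z : S.GraftEdge X) :
    (∃ a, z = .inl a) ∨ ∃ l a, z = graftEdge X l a := by
  obtain a | ⟨l, a, h⟩ := z
  · exact .inl ⟨a, rfl⟩
  · exact .inr ⟨l, a, (graftEdge_of_ne h).symm⟩

/-- The marked edges of a grafting. -/
noncomputable def graftS : (S.M ⊕ Σ l, (X l).M) → S.GraftEdge X :=
  Sum.elim (fun m => .inl (S.s m)) fun m => graftEdge X m.1 ((X m.1).s m.2)

/-- The map forgetting the marked edge of a grafting. -/
def graftP : (S.M ⊕ Σ l, (X l).M) → S.N ⊕ Σ l, (X l).N :=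
  Sum.map S.p fun m => ⟨m.1, (X m.1).p m.2⟩

/-- The output edges of a grafting. -/
noncomputable def graftT : (S.N ⊕ Σ l, (X l).N) → S.GraftEdge X :=
  Sum.elim (fun n => .inl (S.t n)) fun n => graftEdge X n.1 ((X n.1).t n.2)

theorem graftS_injective : Function.Injective (graftS (X := X)) := by
  rintro (m | ⟨l, m⟩) (m' | ⟨l', m'⟩) h
  · exact congrArg _ (S.s_injective (Sum.inl_injective h))
  · exact absurd (graftEdge_eq_inl h.symm).1 ((X l').s_ne_root m')
  · exact absurd (graftEdge_eq_inl h).1 ((X l).s_ne_root m)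
  · obtain ⟨rfl, h2⟩ := Sigma.mk.inj_iff.1 (sigma_eq_of_graftEdge_eq h)
    obtain rfl := (X l).s_injective (heq_iff_eq.1 h2)
    rfl

/-- The lower tree meets an upper tree only in a leaf of `S`, which is by definition not the output
of a node of `S`. -/
theorem graftT_injective : Function.Injective (graftT (X := X)) := by
  rintro (m | ⟨l, m⟩) (m' | ⟨l', m'⟩) h
  · exact congrArg _ (S.t_injective (Sum.inl_injective h))
  · exact absurd ⟨m, (graftEdge_eq_inl h.symm).2.symm⟩ l'.2
  · exact absurd ⟨m', (graftEdge_eq_inl h).2.symm⟩ l.2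
  · obtain ⟨rfl, h2⟩ := Sigma.mk.inj_iff.1 (sigma_eq_of_graftEdge_eq h)
    obtain rfl := (X l).t_injective (heq_iff_eq.1 h2)
    rfl

theorem exists_graftS_eq_iff (z : S.GraftEdge X) :
    (∃ m, graftS (X := X) m = z) ↔ z ≠ .inl S.root := by
  constructor
  · rintro ⟨m | ⟨l, m⟩, rfl⟩ h
    · exact S.s_ne_root m (Sum.inl_injective h)
    · exact (X l).s_ne_root m (graftEdge_eq_inl h).1
  · intro h
    obtain a | ⟨l, a, ha⟩ := z
    · obtain ⟨m, rfl⟩ := (S.exists_s_eq_iff a).2 fun e => h (congrArg _ e)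
      exact ⟨.inl m, rfl⟩
    · obtain ⟨m, rfl⟩ := ((X l).exists_s_eq_iff a).2 ha
      exact ⟨.inr ⟨l, m⟩, graftEdge_of_ne ha⟩

/-- The walk descends within an upper tree to its root, which is a leaf of `S`, and then within `S`.
-/
theorem graft_walk (z : S.GraftEdge X) :
    ∃ k : ℕ, (walkToRoot (graftS (X := X)) graftP graftT)^[k] z = .inl S.root := by
  have h1 : ∀ (k : ℕ) (a : S.A), S.σ^[k] a = S.root →
      ∃ k, (walkToRoot (graftS (X := X)) graftP graftT)^[k] (.inl a) = .inl S.root := by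
    intro k
    induction k with
    | zero => exact fun a h => ⟨0, congrArg Sum.inl h⟩
    | succ k ih =>
      intro a h
      by_cases ha : a = S.root
      · exact ⟨0, congrArg Sum.inl ha⟩
      · obtain ⟨m, rfl⟩ := (S.exists_s_eq_iff a).2 ha
        rw [Function.iterate_succ_apply, S.σ_s] at h
        obtain ⟨j, hj⟩ := ih _ h
        refine ⟨j + 1, ?_⟩
        rw [Function.iterate_succ_apply]
        exact (congrArg _ (walkToRoot_of_eq graftS_injective _ _ (.inl m))).trans hj
  have h2 : ∀ (k : ℕ) (l : S.Leaf) (a : (X l).A), (X l).σ^[k] a = (X l).root →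
      ∃ k, (walkToRoot (graftS (X := X)) graftP graftT)^[k] (graftEdge X l a) = .inl S.root := by
    intro k
    induction k with
    | zero =>
      intro l a h
      obtain rfl : a = (X l).root := h
      obtain ⟨j, hj⟩ := S.walk l.1
      rw [graftEdge_root]
      exact h1 j _ hj
    | succ k ih =>
      intro l a h
      by_cases ha : a = (X l).root
      · subst ha
        obtain ⟨j, hj⟩ := S.walk l.1
        rw [graftEdge_root]
        exact h1 j _ hj
      · obtain ⟨m, rfl⟩ := ((X l).exists_s_eq_iff a).2 ha
        rw [Function.iterate_succ_apply, (X l).σ_s] at h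
        obtain ⟨j, hj⟩ := ih _ _ h
        refine ⟨j + 1, ?_⟩
        rw [Function.iterate_succ_apply]
        exact (congrArg _ (walkToRoot_of_eq graftS_injective _ _ (.inr ⟨l, m⟩))).trans hj
  obtain ⟨a, rfl⟩ | ⟨l, a, rfl⟩ := graftEdge_cases z
  · obtain ⟨k, hk⟩ := S.walk a
    exact h1 k a hk
  · obtain ⟨k, hk⟩ := (X l).walk a
    exact h2 k l a hk

variable (S X)

/-- The grafting of a family of trees onto the leaves of a tree. -/
noncomputable def graft : OpTree where
  A := S.GraftEdge X
  M := S.M ⊕ Σ l, (X l).M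
  N := S.N ⊕ Σ l, (X l).N
  s := graftS
  p := graftP
  t := graftT
  root := .inl S.root
  t_injective := graftT_injective
  s_injective := graftS_injective
  exists_s_eq_iff := exists_graftS_eq_iff
  walk := graft_walk

end Graft

variable {T : OpTree}

/-- Every edge lies in a given subtree containing the root, or above a leaf of it. -/
theorem Subtree.mem_edges_or_mem_ideal (c : T.Subtree) (hc : T.root ∈ c.edges) (a : T.A) :
    a ∈ c.edges ∨ ∃ l ∈ c.edges, (∀ n ∈ c.nodes, T.t n ≠ l) ∧ a ∈ (T.ideal l).edges := by
  have key : ∀ (k : ℕ) (a : T.A), T.σ^[k] a = T.root →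
      a ∈ c.edges ∨ ∃ l ∈ c.edges, (∀ n ∈ c.nodes, T.t n ≠ l) ∧ a ∈ (T.ideal l).edges := by
    intro k
    induction k with
    | zero =>
      rintro a h
      obtain rfl : a = T.root := h
      exact .inl hc
    | succ k ih =>
      intro a h
      by_cases ha : a = T.root
      · subst ha
        exact .inl hc
      -- If the next edge down lies in `c`, either it is a leaf of `c` and `a` is above it, or its
      -- node belongs to `c` and so do all inputs of that node, including `a`.
      obtain h1 | ⟨l, hl, hl', j, hj⟩ := ih _ h
      · by_cases h2 : ∀ n ∈ c.nodes, T.t n ≠ T.σ a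
        · exact .inr ⟨_, h1, h2, 1, rfl⟩
        · push Not at h2
          obtain ⟨n, hn, e⟩ := h2
          obtain ⟨m, rfl⟩ := (T.exists_s_eq_iff a).2 ha
          rw [T.σ_s] at e
          obtain rfl := T.t_injective e
          exact .inl (c.s_mem m hn)
      · exact .inr ⟨l, hl, hl', j + 1, hj⟩
  obtain ⟨k, hk⟩ := T.walk a
  exact key k a hk

/-- Every node lies in a given subtree containing the root, or above a leaf of it. -/
theorem Subtree.mem_nodes_or_mem_ideal (c : T.Subtree) (hc : T.root ∈ c.edges) (n : T.N) :
    n ∈ c.nodes ∨ ∃ l ∈ c.edges, (∀ n ∈ c.nodes, T.t n ≠ l) ∧ n ∈ (T.ideal l).nodes := by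
  obtain h | h := c.mem_edges_or_mem_ideal hc (T.t n)
  · by_cases h2 : ∀ n' ∈ c.nodes, T.t n' ≠ T.t n
    · exact .inr ⟨_, h, h2, 0, rfl⟩
    · push Not at h2
      obtain ⟨n', hn, e⟩ := h2
      obtain rfl := T.t_injective e
      exact .inl hn
  · exact .inr h

end OpTree

variable {I : Type u₁} [Groupoid.{v₁} I] {E : Type u₂} [Groupoid.{v₂} E]
  {B : Type u₃} [Groupoid.{v₃} B] {P : PolyDiagram I E B}

namespace PTree

/-- An embedding which sends leaves to leaves has an ideal subtree as image. -/
theorem image_eq_ideal {X T : PTree P} (f : X ⟶ T)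
    (hf : ∀ a, (¬ ∃ n, X.tree.t n = a) → ¬ ∃ n, T.tree.t n = f.fA a) :
    image f = T.tree.ideal (f.fA X.tree.root) := by
  have h1 : ∀ (k : ℕ) (a : X.tree.A), X.tree.σ^[k] a = X.tree.root →
      ∃ k, T.tree.σ^[k] (f.fA a) = f.fA X.tree.root := by
    intro k
    induction k with
    | zero => exact fun a h => ⟨0, congrArg f.fA h⟩
    | succ k ih =>
      intro a h
      by_cases ha : a = X.tree.root
      · exact ⟨0, congrArg f.fA ha⟩
      · obtain ⟨j, hj⟩ := ih _ h
        exact ⟨j + 1, by rw [Function.iterate_succ_apply, f.σ_fA ha, hj]⟩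
  -- The image is closed upwards: above the image of an inner edge, cartesianness supplies the
  -- inputs; the image of a leaf is a leaf, with nothing above it.
  have h2 : ∀ (k : ℕ) (b : T.tree.A) (x : X.tree.A), T.tree.σ^[k] b = f.fA x →
      ∃ y, f.fA y = b := by
    intro k
    induction k with
    | zero => exact fun b x h => ⟨x, h.symm⟩
    | succ k ih =>
      intro b x h
      obtain ⟨y, hy⟩ := ih _ x h
      by_cases hb : b = T.tree.root
      · rw [hb, T.tree.σ_root] at hy
        exact ⟨y, hy.trans hb.symm⟩
      · obtain ⟨m', rfl⟩ := (T.tree.exists_s_eq_iff b).2 hb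
        rw [T.tree.σ_s] at hy
        by_cases hl : ∃ n, X.tree.t n = y
        · obtain ⟨n, rfl⟩ := hl
          rw [f.comm_t] at hy
          obtain ⟨m, ⟨_, rfl⟩, _⟩ := f.cart n m' (T.tree.t_injective hy).symm
          exact ⟨_, f.comm_s m⟩
        · exact absurd ⟨_, hy.symm⟩ (hf y hl)
  have hA : ∀ b, (∃ y, f.fA y = b) ↔ ∃ k : ℕ, T.tree.σ^[k] b = f.fA X.tree.root := by
    refine fun b => ⟨?_, fun ⟨k, hk⟩ => h2 k b _ hk⟩
    rintro ⟨a, rfl⟩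
    obtain ⟨k, hk⟩ := X.tree.walk a
    exact h1 k a hk
  refine OpTree.Subtree.ext (Set.ext hA) (Set.ext fun n => Iff.trans ?_ (hA (T.tree.t n))) rfl
  constructor
  · rintro ⟨n, rfl⟩
    exact ⟨_, f.comm_t n⟩
  · rintro ⟨y, hy⟩
    by_cases hl : ∃ n, X.tree.t n = y
    · obtain ⟨n', rfl⟩ := hl
      rw [f.comm_t] at hy
      exact ⟨n', T.tree.t_injective hy⟩
    · exact absurd ⟨_, hy.symm⟩ (hf y hl)

end PTree

end TreeBialgebra

/-! ### Grafting of `P`-trees, its universal property, and decompositions -/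

namespace TreeBialgebra

open CategoryTheory

variable {I : Type u₁} [Groupoid.{v₁} I] {E : Type u₂} [Groupoid.{v₂} E]
  {B : Type u₃} [Groupoid.{v₃} B] {P : PolyDiagram I E B}

namespace PTree

open OpTree

section Transport

variable {C : Type u} [Groupoid.{v} C] {a b c d w x y : C}

/-- This and the next two lemmas are transport bookkeeping over free objects, so that the equations
between colours can be substituted away. -/
theorem comp_eqToHom_comp (f : a ⟶ b) (h : b = c) (h' : c = d) (h'' : b = d) :
    (f ≫ eqToHom h) ≫ eqToHom h' = f ≫ eqToHom h'' := by
  subst h h'; simp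

theorem inv_comp_comp_eq {k : a ⟶ b} {f : a ⟶ c} {u : c ⟶ d} {p : b ⟶ x} {q : a ⟶ y} {r : w ⟶ d}
    {e : y = x} {e' : y = w} (e'' : x = w) (h1 : k ≫ p = q ≫ eqToHom e)
    (h2 : f ≫ u = q ≫ eqToHom e' ≫ r) :
    (Groupoid.inv k ≫ f) ≫ u = p ≫ eqToHom e'' ≫ r := by
  subst e e'
  simp only [eqToHom_refl, Category.comp_id, Category.id_comp] at h1 h2 ⊢
  rw [Category.assoc, h2, ← h1, Groupoid.inv_eq_inv]
  simp

theorem comp_eqToHom_inv_eq {z : a ⟶ x} {g : a ⟶ b} {f' : c ⟶ x} {f t : b ⟶ y} {e : b = c}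
    {e' : c = b} {e₂ : x = y} (hz : z = (g ≫ eqToHom e) ≫ f') (ht : t = f)
    (h : eqToHom e' ≫ f = f' ≫ eqToHom e₂) : z ≫ eqToHom e₂ ≫ inv t = g := by
  subst e e₂ hz ht
  simp only [eqToHom_refl, Category.comp_id, Category.id_comp] at h ⊢
  simp [h]

end Transport

section Graft

variable (S : PTree P) (X : S.tree.Leaf → PTree P)

/-- The colours of the edges of a grafting. -/
def graftα : S.tree.GraftEdge (fun l => (X l).tree) → I :=
  Sum.elim S.α fun a => (X a.1).α a.2.1

variable {S X}

theorem graftα_graftEdge {l : S.tree.Leaf} {a : (X l).tree.A} (h : a ≠ (X l).tree.root) :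
    graftα S X (graftEdge (fun l => (X l).tree) l a) = (X l).α a := by
  rw [graftEdge_of_ne h]; rfl

theorem graftα_root (l : S.tree.Leaf) :
    graftα S X (graftEdge (fun l => (X l).tree) l (X l).tree.root) = S.α l.1 := by
  rw [graftEdge_root]; rfl

variable (g : ∀ l, (X l).α (X l).tree.root ⟶ S.α l.1)

open Classical in
/-- The isomorphism between the colour of an edge and its colour in the grafting. -/
noncomputable def graftφ (l : S.tree.Leaf) (a : (X l).tree.A) :
    (X l).α a ⟶ graftα S X (graftEdge (fun l => (X l).tree) l a) :=
  if h : a = (X l).tree.root then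
    eqToHom (by rw [h]) ≫ g l ≫ eqToHom (by rw [h, graftα_root])
  else eqToHom (graftα_graftEdge h).symm

theorem graftφ_root (l : S.tree.Leaf) :
    graftφ g l (X l).tree.root = g l ≫ eqToHom (graftα_root l).symm := by
  rw [graftφ, dif_pos rfl]; simp

theorem graftφ_of_ne {l : S.tree.Leaf} {a : (X l).tree.A} (h : a ≠ (X l).tree.root) :
    graftφ g l a = eqToHom (graftα_graftEdge h).symm := dif_neg h

/-- The grafting of a family of `P`-trees onto the leaves of a `P`-tree. -/
noncomputable def graft : PTree P where
  tree := S.tree.graft fun l => (X l).tree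
  α := graftα S X
  β := Sum.elim S.β fun m => (X m.1).β m.2
  γ := Sum.elim S.γ fun n => (X n.1).γ n.2
  -- The root of an upper tree takes the colour of a leaf of `S`, so its outer squares are corrected
  -- by `graftφ`. On input edges this is a mere transport; the gluing isomorphism enters only in
  -- `right`, at a node whose output is the root.
  left := Sum.rec S.left fun m =>
    Groupoid.inv (graftφ g m.1 ((X m.1).tree.s m.2)) ≫ (X m.1).left m.2
  mid := Sum.rec S.mid fun m => (X m.1).mid m.2
  right := Sum.rec S.right fun n => (X n.1).right n.2 ≫ graftφ g n.1 ((X n.1).tree.t n.2)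
  cartesian := by
    -- Grafting identifies edges but leaves the inputs of each node unchanged, so the fibre over a
    -- node is that of the part containing it.
    rintro (n | ⟨l, n⟩)
    · let e : {m : S.tree.M // S.tree.p m = n} ≃ {m : (S.tree.graft fun l => (X l).tree).M //
          (S.tree.graft fun l => (X l).tree).p m = .inl n} :=
        Equiv.ofBijective (fun m => ⟨.inl m.1, congrArg Sum.inl m.2⟩) <| by
          constructor
          · intro m m' h
            exact Subtype.ext (Sum.inl_injective (congrArg Subtype.val h))
          · rintro ⟨m | m, h⟩
            · exact ⟨⟨m, Sum.inl_injective h⟩, rfl⟩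
            · cases h
      refine @Functor.isEquivalence_of_comp_left _ _ _ _ _ _ (Discrete.equivalence e).functor _
        inferInstance ?_
      have := S.cartesian n
      exact Functor.isEquivalence_of_iso (F := Discrete.functor
        fun m : {m : S.tree.M // S.tree.p m = n} =>
          (CostructuredArrow.mk (S.mid m.1 ≫ eqToHom (congrArg S.γ m.2)) :
            CostructuredArrow P.p (S.γ n)))
        (Discrete.natIso fun _ => Iso.refl _)
    · let e : {m : (X l).tree.M // (X l).tree.p m = n} ≃
          {m : (S.tree.graft fun l => (X l).tree).M //
            (S.tree.graft fun l => (X l).tree).p m = .inr ⟨l, n⟩} :=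
        Equiv.ofBijective (fun m => ⟨.inr ⟨l, m.1⟩,
          congrArg (fun n => Sum.inr (Sigma.mk l n)) m.2⟩) <| by
          constructor
          · intro m m' h
            exact Subtype.ext (eq_of_heq
              (Sigma.mk.inj_iff.1 (Sum.inr_injective (congrArg Subtype.val h))).2)
          · rintro ⟨m | ⟨l', m⟩, h⟩
            · cases h
            · cases Sum.inr_injective h
              exact ⟨⟨m, rfl⟩, rfl⟩
      refine @Functor.isEquivalence_of_comp_left _ _ _ _ _ _ (Discrete.equivalence e).functor _
        inferInstance ?_
      have := (X l).cartesian n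
      exact Functor.isEquivalence_of_iso (F := Discrete.functor
        fun m : {m : (X l).tree.M // (X l).tree.p m = n} =>
          (CostructuredArrow.mk ((X l).mid m.1 ≫ eqToHom (congrArg (X l).γ m.2)) :
            CostructuredArrow P.p ((X l).γ n)))
        (Discrete.natIso fun _ => Iso.refl _)

/-- The inclusion of the lower tree of a grafting. -/
noncomputable def graftLower : S ⟶ graft g where
  fA := Sum.inl
  fM := Sum.inl
  fN := Sum.inl
  comm_s _ := rfl
  comm_p _ := rfl
  comm_t _ := rfl
  cart n m' h := by
    obtain m | m := m'
    · exact ⟨m, ⟨Sum.inl_injective h, rfl⟩, fun _ hy => Sum.inl_injective hy.2⟩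
    · cases h
  φA _ := 𝟙 _
  φM _ := 𝟙 _
  φN _ := 𝟙 _
  comm_left m := ((congrArg (S.left m ≫ ·) (P.s.map_id _)).trans (Category.comp_id _)).trans
    ((Category.id_comp _).trans (Category.id_comp _)).symm
  comm_mid m := ((congrArg (· ≫ S.mid m) (P.p.map_id _)).trans (Category.id_comp _)).trans
    ((congrArg (S.mid m ≫ ·) (Category.id_comp _)).trans (Category.comp_id _)).symm
  comm_right n := ((congrArg (· ≫ S.right n) (P.t.map_id _)).trans (Category.id_comp _)).trans
    ((congrArg (S.right n ≫ ·) (Category.id_comp _)).trans (Category.comp_id _)).symm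

/-- The inclusion of the upper trees of a grafting. -/
noncomputable def graftUpper (l : S.tree.Leaf) : X l ⟶ graft g where
  fA := graftEdge (fun l => (X l).tree) l
  fM m := .inr ⟨l, m⟩
  fN n := .inr ⟨l, n⟩
  comm_s _ := rfl
  comm_p _ := rfl
  comm_t _ := rfl
  cart n m' h := by
    obtain m | ⟨l', m⟩ := m'
    · cases h
    · cases Sum.inr_injective h
      refine ⟨m, ⟨rfl, rfl⟩, fun _ hy => ?_⟩
      cases Sum.inr_injective hy.2
      rfl
  φA := graftφ g l
  φM _ := 𝟙 _
  φN _ := 𝟙 _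
  comm_left m := ((congrArg ((X l).left m ≫ ·) (P.s.map_id _)).trans (Category.comp_id _)).trans
    ((congrArg (graftφ g l _ ≫ ·) (Category.id_comp _)).trans ((Category.assoc _ _ _).symm.trans
      ((congrArg (· ≫ (X l).left m) (Groupoid.comp_inv _)).trans (Category.id_comp _)))).symm
  comm_mid m := ((congrArg (· ≫ (X l).mid m) (P.p.map_id _)).trans (Category.id_comp _)).trans
    ((congrArg ((X l).mid m ≫ ·) (Category.id_comp _)).trans (Category.comp_id _)).symm
  comm_right n := ((congrArg (· ≫ (X l).right n ≫ graftφ g l _) (P.t.map_id _)).trans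
    (Category.id_comp _)).trans
    (congrArg ((X l).right n ≫ ·) (Category.comp_id _)).symm

variable {g}

/-- The parts cover the grafting and their decorations are invertible, so the inclusions are jointly
epimorphic. -/
theorem graft_hom_ext {T : PTree P} {f f' : graft g ⟶ T}
    (h : graftLower g ≫ f = graftLower g ≫ f') (h' : ∀ l, graftUpper g l ≫ f = graftUpper g l ≫ f') :
    f = f' := by
  have hA : ∀ z, f.fA z = f'.fA z := by
    intro z
    obtain ⟨a, rfl⟩ | ⟨l, a, rfl⟩ := graftEdge_cases z
    · exact congrArg (fun k : S ⟶ T => k.fA a) h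
    · exact congrArg (fun k : X l ⟶ T => k.fA a) (h' l)
  have hM : ∀ z, f.fM z = f'.fM z := by
    rintro (m | ⟨l, m⟩)
    · exact congrArg (fun k : S ⟶ T => k.fM m) h
    · exact congrArg (fun k : X l ⟶ T => k.fM m) (h' l)
  have hN : ∀ z, f.fN z = f'.fN z := by
    rintro (m | ⟨l, m⟩)
    · exact congrArg (fun k : S ⟶ T => k.fN m) h
    · exact congrArg (fun k : X l ⟶ T => k.fN m) (h' l)
  refine hom_ext hA hM hN ?_ ?_ ?_
  · intro z
    obtain ⟨a, rfl⟩ | ⟨l, a, rfl⟩ := graftEdge_cases z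
    · exact (cancel_epi ((graftLower g).φA a)).1
        ((Category.assoc _ _ _).symm.trans (φA_congr h a))
    · exact (cancel_epi ((graftUpper g l).φA a)).1
        ((Category.assoc _ _ _).symm.trans (φA_congr (h' l) a))
  · rintro (a | ⟨l, a⟩)
    · exact (cancel_epi ((graftLower g).φM a)).1
        ((Category.assoc _ _ _).symm.trans (φM_congr h a))
    · exact (cancel_epi ((graftUpper g l).φM a)).1
        ((Category.assoc _ _ _).symm.trans (φM_congr (h' l) a))
  · rintro (a | ⟨l, a⟩)
    · exact (cancel_epi ((graftLower g).φN a)).1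
        ((Category.assoc _ _ _).symm.trans (φN_congr h a))
    · exact (cancel_epi ((graftUpper g l).φN a)).1
        ((Category.assoc _ _ _).symm.trans (φN_congr (h' l) a))

section Desc

variable {T : PTree P} (θ : S ⟶ T) (ζ : ∀ l, X l ⟶ T)

/-- The map on the edges of a grafting induced by maps on the edges of its parts. -/
def graftDescA : S.tree.GraftEdge (fun l => (X l).tree) → T.tree.A :=
  Sum.elim θ.fA fun x => (ζ x.1).fA x.2.1

/-- The isomorphisms of colours on a grafting induced by those on its parts. -/
def graftDescφ (z : S.tree.GraftEdge (fun l => (X l).tree)) :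
    graftα S X z ⟶ T.α (graftDescA θ ζ z) :=
  match z with
  | .inl a => θ.φA a
  | .inr x => (ζ x.1).φA x.2.1

theorem graftDescφ_eqToHom {z z' : S.tree.GraftEdge (fun l => (X l).tree)} (h : z = z') :
    eqToHom (congrArg (graftα S X) h) ≫ graftDescφ θ ζ z' =
      graftDescφ θ ζ z ≫ eqToHom (congrArg (T.α ∘ graftDescA θ ζ) h) := by
  subst h; simp

variable {θ ζ} (hr : ∀ l, (ζ l).fA (X l).tree.root = θ.fA l.1)

include hr in
theorem graftDescA_graftEdge (l : S.tree.Leaf) (a : (X l).tree.A) :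
    graftDescA θ ζ (graftEdge (fun l => (X l).tree) l a) = (ζ l).fA a := by
  by_cases h : a = (X l).tree.root
  · subst h
    rw [graftEdge_root]
    exact (hr l).symm
  · rw [graftEdge_of_ne h]
    rfl

/-- At the root of an upper tree this is the gluing condition `hg`; at any other edge it is a
transport. -/
theorem graftDescφ_graftEdge
    (hg : ∀ l, (ζ l).φA (X l).tree.root ≫ eqToHom (congrArg T.α (hr l)) = g l ≫ θ.φA l.1)
    (l : S.tree.Leaf) (a : (X l).tree.A) :
    graftφ g l a ≫ graftDescφ θ ζ (graftEdge (fun l => (X l).tree) l a) =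
      (ζ l).φA a ≫ eqToHom (congrArg T.α (graftDescA_graftEdge hr l a).symm) := by
  by_cases h : a = (X l).tree.root
  · subst h
    have h1 := graftDescφ_eqToHom θ ζ (graftEdge_root (X := fun l => (X l).tree) l).symm
    refine (congrArg (· ≫ _) (graftφ_root g l)).trans ((Category.assoc _ _ _).trans ?_)
    refine (congrArg (g l ≫ ·) h1).trans ((Category.assoc _ _ _).symm.trans ?_)
    exact (congrArg (· ≫ _) (hg l).symm).trans (comp_eqToHom_comp _ _ _ _)
  · have h1 := graftDescφ_eqToHom θ ζ (graftEdge_of_ne (X := fun l => (X l).tree) h).symm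
    exact (congrArg (· ≫ _) (graftφ_of_ne g h)).trans h1

/-- The embedding of a grafting induced by compatible embeddings of its parts. -/
def graftDesc
    (hg : ∀ l, (ζ l).φA (X l).tree.root ≫ eqToHom (congrArg T.α (hr l)) = g l ≫ θ.φA l.1) :
    graft g ⟶ T where
  fA := graftDescA θ ζ
  fM := Sum.elim θ.fM fun m => (ζ m.1).fM m.2
  fN := Sum.elim θ.fN fun n => (ζ n.1).fN n.2
  comm_s := by
    rintro (m | ⟨l, m⟩)
    · exact θ.comm_s m
    · exact (graftDescA_graftEdge hr l _).trans ((ζ l).comm_s m)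
  comm_p := by
    rintro (m | ⟨l, m⟩)
    · exact θ.comm_p m
    · exact (ζ l).comm_p m
  comm_t := by
    rintro (m | ⟨l, m⟩)
    · exact θ.comm_t m
    · exact (graftDescA_graftEdge hr l _).trans ((ζ l).comm_t m)
  cart := by
    rintro (n | ⟨l, n⟩) m' h
    · obtain ⟨m, ⟨h1, h2⟩, h3⟩ := θ.cart n m' h
      refine ⟨.inl m, ⟨congrArg Sum.inl h1, h2⟩, ?_⟩
      rintro (y | y) ⟨h4, h5⟩
      · exact congrArg Sum.inl (h3 y ⟨Sum.inl_injective h4, h5⟩)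
      · cases h4
    · obtain ⟨m, ⟨h1, h2⟩, h3⟩ := (ζ l).cart n m' h
      refine ⟨.inr ⟨l, m⟩, ⟨congrArg (fun n => Sum.inr (Sigma.mk l n)) h1, h2⟩, ?_⟩
      rintro (y | ⟨l', y⟩) ⟨h4, h5⟩
      · cases h4
      · cases Sum.inr_injective h4
        exact congrArg (fun n => Sum.inr (Sigma.mk _ n)) (h3 y ⟨rfl, h5⟩)
  φA := graftDescφ θ ζ
  φM z := match z with
    | .inl m => θ.φM m
    | .inr m => (ζ m.1).φM m.2
  φN z := match z with
    | .inl m => θ.φN m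
    | .inr m => (ζ m.1).φN m.2
  comm_left := by
    rintro (m | ⟨l, m⟩)
    · exact θ.comm_left m
    · exact inv_comp_comp_eq _ (graftDescφ_graftEdge hr hg l _) ((ζ l).comm_left m)
  comm_mid := by
    rintro (m | ⟨l, m⟩)
    · exact θ.comm_mid m
    · exact (ζ l).comm_mid m
  comm_right := by
    rintro (m | ⟨l, m⟩)
    · exact θ.comm_right m
    · refine ((ζ l).comm_right m).trans ?_
      refine Eq.trans ?_ (Category.assoc _ _ _).symm
      refine congrArg ((X l).right m ≫ ·) ?_
      refine Eq.trans ?_ (Category.assoc _ _ _)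
      refine Eq.trans ?_ (congrArg (· ≫ _) (graftDescφ_graftEdge hr hg l _).symm)
      exact (comp_eqToHom_comp _ _ _ _).symm

variable (hg : ∀ l, (ζ l).φA (X l).tree.root ≫ eqToHom (congrArg T.α (hr l)) = g l ≫ θ.φA l.1)

theorem graftLower_desc : graftLower g ≫ graftDesc hr hg = θ := by
  refine Hom.ext rfl rfl rfl (heq_of_eq (funext fun a => ?_)) (heq_of_eq (funext fun a => ?_))
      (heq_of_eq (funext fun a => ?_))
  · exact Category.id_comp _
  · exact Category.id_comp _
  · exact Category.id_comp _

theorem graftUpper_desc (l : S.tree.Leaf) : graftUpper g l ≫ graftDesc hr hg = ζ l := by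
  refine hom_ext (graftDescA_graftEdge hr l) (fun _ => rfl) (fun _ => rfl) (fun a => ?_)
    (fun a => ?_) (fun a => ?_)
  · exact (congrArg (· ≫ _) (graftDescφ_graftEdge hr hg l a)).trans
      ((comp_eqToHom_comp _ _ _ rfl).trans (Category.comp_id _))
  · exact (Category.comp_id _).trans (Category.id_comp _)
  · exact (Category.comp_id _).trans (Category.id_comp _)

/-- The embedding of a grafting into a tree is an isomorphism if the lower tree contains the root
and the upper trees are the ideal subtrees generated by its leaves. -/
theorem isIso_graftDesc (hθ : T.tree.root ∈ (image θ).edges)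
    (hζ : ∀ l, image (ζ l) = T.tree.ideal (θ.fA l.1)) : IsIso (graftDesc hr hg) := by
  refine isIso_of_surjective _ (fun n => ?_) ?_
  · obtain ⟨n, rfl⟩ | ⟨_, ⟨a, rfl⟩, h, hn⟩ := (image θ).mem_nodes_or_mem_ideal hθ n
    · exact ⟨.inl n, rfl⟩
    · have ha : ¬ ∃ n, S.tree.t n = a := by
        rintro ⟨n, rfl⟩
        exact h _ ⟨n, rfl⟩ (θ.comm_t n).symm
      rw [← hζ ⟨a, ha⟩] at hn
      obtain ⟨n, rfl⟩ := hn
      exact ⟨.inr ⟨⟨a, ha⟩, n⟩, rfl⟩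
  · obtain ⟨a, ha⟩ := hθ
    by_cases h : a = S.tree.root
    · subst h; exact ha
    · obtain ⟨m, rfl⟩ := (S.tree.exists_s_eq_iff a).2 h
      rw [θ.comm_s] at ha
      exact absurd ha (T.tree.s_ne_root _)

end Desc

/-- Nothing is grafted above an upper tree. This is the hypothesis of `image_eq_ideal`, which makes
the upper parts ideal subtrees. -/
theorem graftEdge_leaf {l : S.tree.Leaf} {a : (X l).tree.A} (h : ¬ ∃ n, (X l).tree.t n = a) :
    ¬ ∃ n, (graft g).tree.t n = graftEdge (fun l => (X l).tree) l a := by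
  rintro ⟨n | ⟨l', n⟩, hn⟩
  · exact l.2 ⟨n, (graftEdge_eq_inl (X := fun l => (X l).tree) hn.symm).2.symm⟩
  · obtain ⟨rfl, h2⟩ := Sigma.mk.inj_iff.1
      (sigma_eq_of_graftEdge_eq (X := fun l => (X l).tree) hn)
    exact h ⟨n, eq_of_heq h2⟩

variable (S X) in
/-- The decompositions of a tree as a grafting. -/
def Decomp (T : PTree P) : Type _ :=
  {d : (S ⟶ T) × (∀ l, X l ⟶ T) //
    T.tree.root ∈ (image d.1).edges ∧ ∀ l, image (d.2 l) = T.tree.ideal (d.1.fA l.1)}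

variable (g) in
/-- The decomposition of a tree given by an isomorphism with a grafting. -/
noncomputable def decompOfIso {T : PTree P} (f : graft g ≅ T) : Decomp S X T :=
  ⟨(graftLower g ≫ f.hom, fun l => graftUpper g l ≫ f.hom), ⟨_, iso_fA_root f⟩, fun l => by
    rw [image_eq_ideal (graftUpper g l ≫ f.hom) fun a ha => iso_leaf f (graftEdge_leaf ha)]
    exact congrArg (fun z => T.tree.ideal (f.hom.fA z))
      (graftEdge_root (X := fun l => (X l).tree) l)⟩

theorem Decomp.fA_root {T : PTree P} (d : Decomp S X T) (l : S.tree.Leaf) :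
    (d.1.2 l).fA (X l).tree.root = d.1.1.fA l.1 :=
  congrArg OpTree.Subtree.root (d.2.2 l)

/-- The gluing isomorphisms of a decomposition. -/
noncomputable def Decomp.glue {T : PTree P} (d : Decomp S X T) (l : S.tree.Leaf) :
    (X l).α (X l).tree.root ⟶ S.α l.1 :=
  (d.1.2 l).φA (X l).tree.root ≫ eqToHom (congrArg T.α (d.fA_root l)) ≫ inv (d.1.1.φA l.1)

theorem glue_decompOfIso {T : PTree P} (f : graft g ≅ T) (l : S.tree.Leaf) :
    (decompOfIso g f).glue l = g l := by
  have h := f.hom.φA_eqToHom (graftEdge_root (X := fun l => (X l).tree) l)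
  exact comp_eqToHom_inv_eq (congrArg (· ≫ f.hom.φA _) (graftφ_root g l)) (Category.id_comp _) h

variable (S X) in
/-- Decompositions of a tree as a grafting of given trees correspond to isomorphisms with the
graftings of these trees along all possible gluing isomorphisms. -/
noncomputable def decompEquiv (T : PTree P) :
    (Σ g : ∀ l, (X l).α (X l).tree.root ⟶ S.α l.1, graft g ≅ T) ≃ Decomp S X T :=
  Equiv.ofBijective (fun x => decompOfIso x.1 x.2) <| by
    constructor
    · rintro ⟨g, f⟩ ⟨g', f'⟩ h
      -- The gluing isomorphisms can be read off from the decomposition; once they agree, the two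
      -- isomorphisms agree on all parts of one grafting.
      obtain rfl : g = g' := funext fun l => by
        rw [← glue_decompOfIso f, ← glue_decompOfIso f']
        exact congrArg (fun d : Decomp S X T => d.glue l) h
      congr 1
      refine Iso.ext (graft_hom_ext ?_ fun l => ?_)
      · exact congrArg (fun d : Decomp S X T => d.1.1) h
      · exact congrArg (fun d : Decomp S X T => d.1.2 l) h
    -- `Decomp.glue` is the unique choice for which the embeddings satisfy the gluing condition;
    -- their common extension is an isomorphism because a cut and the ideals above its leaves cover
    -- the tree.
    · intro d
      have hg : ∀ l, (d.1.2 l).φA (X l).tree.root ≫ eqToHom (congrArg T.α (d.fA_root l)) =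
          d.glue l ≫ d.1.1.φA l.1 := fun l => by simp [Decomp.glue]
      have := isIso_graftDesc d.fA_root hg d.2.1 d.2.2
      exact ⟨⟨d.glue, asIso (graftDesc d.fA_root hg)⟩, Subtype.ext
        (Prod.ext (graftLower_desc d.fA_root hg) (funext fun l => graftUpper_desc d.fA_root hg l))⟩

end Graft

end PTree

end TreeBialgebra

/-! ### Hom-sets in groupoids and finiteness of colours -/

namespace TreeBialgebra

open CategoryTheory

section Groupoid

variable {G : Type u} [Category.{v} G] [IsGroupoid G]

/-- In a groupoid, the arrows into an object are a torsor under its vertex group, if any. -/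
theorem nonempty_hom_equiv_aut {x y : G} (f : x ⟶ y) : Nonempty ((x ⟶ y) ≃ Aut y) :=
  ⟨{ toFun := fun k => asIso (inv f ≫ k)
     invFun := fun k => f ≫ k.hom
     left_inv := fun k => by simp
     right_inv := fun k => Iso.ext (by simp) }⟩

theorem finite_hom_of_finite_aut {x y : G} [Finite (Aut y)] : Finite (x ⟶ y) := by
  obtain h | ⟨⟨f⟩⟩ := isEmpty_or_nonempty (x ⟶ y)
  · infer_instance
  · obtain ⟨e⟩ := nonempty_hom_equiv_aut f
    exact Finite.of_equiv _ e.symm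

open Classical in
theorem card_hom_eq (x y : G) :
    Nat.card (x ⟶ y) = if Pi0.mk x = Pi0.mk y then Nat.card (Aut y) else 0 := by
  split_ifs with h
  · obtain ⟨f⟩ := (Pi0.mk_eq_mk_iff _ _).1 h
    obtain ⟨e⟩ := nonempty_hom_equiv_aut f.hom
    exact Nat.card_congr e
  · have : IsEmpty (x ⟶ y) :=
      ⟨fun f => h ((Pi0.mk_eq_mk_iff _ _).2 ⟨asIso f⟩)⟩
    exact Nat.card_of_isEmpty

end Groupoid

variable {I : Type u₁} [Groupoid.{v₁} I] {E : Type u₂} [Groupoid.{v₂} E]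
  {B : Type u₃} [Groupoid.{v₃} B] {P : PolyDiagram I E B}

/-- Arrows in the core of a category are isomorphisms. -/
def coreHomEquiv {C : Type u} [Category.{v} C] (x y : Core C) : (x ⟶ y) ≃ (x.of ≅ y.of) where
  toFun f := f.iso
  invFun f := ⟨f⟩
  left_inv _ := rfl
  right_inv _ := rfl

section Trivial

/-- The tree with one edge and no nodes. -/
def OpTree.trivial : OpTree where
  A := Unit
  M := Empty
  N := Empty
  s := Empty.elim
  p := Empty.elim
  t := Empty.elim
  root := ()
  t_injective := fun x => x.elim
  s_injective := fun x => x.elim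
  exists_s_eq_iff _ := ⟨fun ⟨m, _⟩ => m.elim, fun h => absurd rfl h⟩
  walk _ := ⟨0, rfl⟩

variable (P) in
/-- The `P`-tree with one edge of a given colour and no nodes. -/
def PTree.trivial (w : I) : PTree P where
  tree := OpTree.trivial
  α _ := w
  β := Empty.elim
  γ := Empty.elim
  left m := m.elim
  mid m := m.elim
  right m := m.elim
  cartesian n := n.elim

variable (P) in
/-- An endomorphism of a colour, as an endomorphism of the trivial tree. -/
def PTree.trivialMap {w : I} (f : w ⟶ w) : PTree.trivial P w ⟶ PTree.trivial P w where
  fA := id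
  fM := id
  fN := id
  comm_s m := m.elim
  comm_p m := m.elim
  comm_t m := m.elim
  cart m := m.elim
  φA _ := f
  φM m := m.elim
  φN m := m.elim
  comm_left m := m.elim
  comm_mid m := m.elim
  comm_right m := m.elim

-- The vertex group of a colour embeds in that of the trivial tree of this colour, so finiteness
-- passes from trees to colours.
include P in
theorem finite_colour_hom (hP : ∀ T : Trees P, Finite (Aut T)) (v w : I) : Finite (v ⟶ w) := by
  have h : ∀ f : w ⟶ w, IsIso (PTree.trivialMap P f) := fun f =>
    PTree.isIso_of_surjective _ (fun n => n.elim) rfl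
  have := hP ⟨PTree.trivial P w⟩
  have : Finite (Aut w) := by
    refine Finite.of_injective (β := Aut (⟨PTree.trivial P w⟩ : Trees P))
      (fun f => Core.isoMk (@asIso _ _ _ _ _ (h f.hom))) fun f g e => Iso.ext ?_
    have h1 := congrArg (fun k : Aut (⟨PTree.trivial P w⟩ : Trees P) =>
      (show w ⟶ w from k.hom.iso.hom.φA ())) e
    exact h1
  exact finite_hom_of_finite_aut

end Trivial

namespace OpTree

instance (T : OpTree) : Finite T.Subtree :=
  Finite.of_injective (fun c => (c.edges, c.nodes, c.root)) fun c d h => by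
    simp only [Prod.mk.injEq] at h
    exact Subtree.ext h.1 h.2.1 h.2.2

theorem Subtree.root_eq {T : OpTree} (c : T.Subtree) (hc : T.root ∈ c.edges) : c.root = T.root := by
  by_contra h
  obtain ⟨m, _, hm⟩ := (c.exists_s_eq_iff _ hc).2 (Ne.symm h)
  exact T.s_ne_root m hm

noncomputable instance fintypeLeaf (T : OpTree) : Fintype T.Leaf := Fintype.ofFinite _

end OpTree

/-! ### Counting cuts through embeddings, decompositions and gluings -/

open OpTree PTree

section Counting

/-- The monomial of a family of isomorphism classes of trees. -/
noncomputable def familyMon {ι : Type} (x : ι → Pi0 (Trees P)) : Mon P :=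
  ∑ᶠ i, Finsupp.single (x i) 1

theorem familyMon_comp_equiv {ι κ : Type} (e : ι ≃ κ) (x : κ → Pi0 (Trees P)) :
    familyMon (fun i => x (e i)) = familyMon x :=
  finsum_comp_equiv e (f := fun i => Finsupp.single (x i) 1)

/-- Every member of such a family is one of the finitely many variables of `d`. -/
theorem finite_familyMon_eq {ι : Type} [Finite ι] (d : Mon P) :
    {x : ι → Pi0 (Trees P) | familyMon x = d}.Finite := by
  classical
  have := Fintype.ofFinite ι
  refine (Set.Finite.pi' fun _ : ι => d.support.finite_toSet).subset ?_
  rintro x rfl i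
  simp only [familyMon, finsum_eq_sum_of_fintype, Finset.mem_coe, Finsupp.mem_support_iff,
    Finsupp.finsetSum_apply]
  intro h
  have := (Finset.sum_eq_zero_iff.1 h) i (Finset.mem_univ _)
  simp at this

variable (hP : ∀ T : Trees P, Finite (Aut T))

include hP in
theorem finite_iso (X Y : PTree P) : Finite (X ≅ Y) := by
  have := hP ⟨Y⟩
  have := finite_hom_of_finite_aut (x := (⟨X⟩ : Trees P)) (y := ⟨Y⟩)
  exact Finite.of_equiv _ (coreHomEquiv (⟨X⟩ : Trees P) ⟨Y⟩)

-- There are finitely many possible images, and embeddings with a given image are isomorphisms onto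
-- it.
include hP in
theorem finite_embedding (X Y : PTree P) : Finite (X ⟶ Y) := by
  have := finite_iso hP
  have h (U : Y.tree.Subtree) : Finite {f : X ⟶ Y // image f = U} :=
    Finite.of_equiv _ (imageEquiv X Y U)
  exact Finite.of_equiv _ (Equiv.sigmaFiberEquiv (image (X := X) (T := Y)))

open Classical in
theorem card_iso (X Y : PTree P) : Nat.card (X ≅ Y) =
    if Pi0.mk (⟨X⟩ : Trees P) = Pi0.mk ⟨Y⟩ then Nat.card (Aut (⟨Y⟩ : Trees P)) else 0 := by
  rw [← card_hom_eq]
  exact Nat.card_congr (coreHomEquiv (⟨X⟩ : Trees P) ⟨Y⟩).symm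

/-- The isomorphism class of the ideal subtree generated by an edge. -/
def idealClass (T : PTree P) (a : T.tree.A) : Pi0 (Trees P) :=
  Pi0.mk ⟨T.restrict (T.tree.ideal a)⟩

/-- The family of the classes of the ideal subtrees generated by the leaves of an embedded tree. -/
def leafClass {S T : PTree P} (θ : S ⟶ T) (l : S.tree.Leaf) : Pi0 (Trees P) :=
  idealClass T (θ.fA l.1)

/-- An embedding is an isomorphism onto its image and so matches the leaves; the monomial therefore
depends on the cut alone. -/
theorem familyMon_leafClass {S T : PTree P} {θ : S ⟶ T} {c : T.tree.Subtree} (h : image θ = c) :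
    familyMon (leafClass θ) = familyMon fun l : c.toTree.Leaf => idealClass T l.1.1 := by
  obtain ⟨g, hg⟩ := (imageEquiv S T c).surjective ⟨θ, h⟩
  have h1 : ∀ a, (g.hom.fA a).1 = θ.fA a := fun a =>
    congrArg (fun f : {f : S ⟶ T // image f = c} => f.1.fA a) hg
  refine Eq.trans ?_ (familyMon_comp_equiv (leafEquiv g) _)
  exact congrArg familyMon (funext fun l => congrArg (idealClass T) (h1 l.1).symm)

/-- The cuts of a tree with a given class below the cut and a given monomial above it. -/
def CutsOf (T : PTree P) (y : Pi0 (Trees P)) (d : Mon P) : Type :=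
  {c : T.tree.Cut // Pi0.mk (⟨T.restrict c.1⟩ : Trees P) = y ∧
    familyMon (fun l : c.1.toTree.Leaf => idealClass T l.1.1) = d}

-- Embeddings are sorted by image. Those with a given cut as image are the isomorphisms from `S` to
-- the tree below it, a torsor under `Aut S`.
include hP in
theorem card_cutsOf_mul (S T : PTree P) (d : Mon P) :
    Nat.card (CutsOf T (Pi0.mk ⟨S⟩) d) * Nat.card (Aut (⟨S⟩ : Trees P)) =
      Nat.card {θ : S ⟶ T // T.tree.root ∈ (image θ).edges ∧ familyMon (leafClass θ) = d} := by
  have := finite_embedding hP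
  have : Finite (CutsOf T (Pi0.mk ⟨S⟩) d) := by unfold CutsOf; infer_instance
  have := Fintype.ofFinite (CutsOf T (Pi0.mk ⟨S⟩) d)
  let e : {θ : S ⟶ T // T.tree.root ∈ (image θ).edges ∧ familyMon (leafClass θ) = d} ≃
      Σ c : CutsOf T (Pi0.mk ⟨S⟩) d, {θ : S ⟶ T // image θ = c.1.1} :=
    { toFun := fun θ => ⟨⟨⟨image θ.1, θ.2.1⟩, (Pi0.mk_eq_mk_iff _ _).2
        ⟨Core.isoMk ((imageEquiv S T _).symm ⟨θ.1, rfl⟩).symm⟩,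
        (familyMon_leafClass rfl).symm.trans θ.2.2⟩, ⟨θ.1, rfl⟩⟩
      invFun := fun x => ⟨x.2.1, by rw [x.2.2]; exact x.1.1.2,
        (familyMon_leafClass x.2.2).trans x.1.2.2⟩
      left_inv := fun _ => rfl
      right_inv := by
        rintro ⟨⟨⟨c, hc⟩, h1, h2⟩, θ, h⟩
        dsimp only at h
        subst h
        rfl }
  rw [Nat.card_congr e, Nat.card_sigma]
  have h (c : CutsOf T (Pi0.mk ⟨S⟩) d) :
      Nat.card {θ : S ⟶ T // image θ = c.1.1} = Nat.card (Aut (⟨S⟩ : Trees P)) := by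
    have h1 := c.2.1
    rw [← Nat.card_congr (imageEquiv S T _), ← Nat.card_congr ⟨Iso.symm, Iso.symm, fun _ => rfl,
      fun _ => rfl⟩, card_iso, if_pos h1]
  simp [h, Nat.card_eq_fintype_card]

/-- The order of the vertex group of an isomorphism class of trees. -/
noncomputable def autCard (x : Pi0 (Trees P)) : ℕ := Nat.card (Aut x.rep)

include hP in
theorem autCard_ne_zero (x : Pi0 (Trees P)) : autCard x ≠ 0 := by
  have := hP x.rep
  have : Nonempty (Aut x.rep) := ⟨Iso.refl _⟩
  exact Nat.card_ne_zero.2 ⟨this, inferInstance⟩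

open Classical in
theorem card_iso_rep (x : Pi0 (Trees P)) (Y : PTree P) : Nat.card (x.rep.of ≅ Y) =
    if x = Pi0.mk ⟨Y⟩ then autCard x else 0 := by
  rw [← Nat.card_congr ⟨Iso.symm, Iso.symm, fun _ => rfl, fun _ => rfl⟩, card_iso]
  refine if_congr ?_ rfl rfl
  rw [show (⟨x.rep.of⟩ : Trees P) = x.rep from rfl, Pi0.mk_rep, eq_comm]

-- Once `θ` is chosen, the upper embeddings are independent: the one at `l` is an isomorphism from
-- the representative of `x l` onto the ideal generated by `l`. There are `autCard (x l)` of them if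
-- the classes agree, and none otherwise.
include hP in
theorem card_decomp_eq_mul (S T : PTree P) (x : S.tree.Leaf → Pi0 (Trees P)) :
    Nat.card (Decomp S (fun l => (x l).rep.of) T) =
      Nat.card {θ : S ⟶ T // T.tree.root ∈ (image θ).edges ∧ leafClass θ = x} *
        ∏ l, autCard (x l) := by
  classical
  have := finite_embedding hP
  have := Fintype.ofFinite (S ⟶ T)
  let e : Decomp S (fun l => (x l).rep.of) T ≃
      Σ θ : {θ : S ⟶ T // T.tree.root ∈ (image θ).edges},
        ∀ l, {ζ : (x l).rep.of ⟶ T // image ζ = T.tree.ideal (θ.1.fA l.1)} :=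
    { toFun := fun d => ⟨⟨d.1.1, d.2.1⟩, fun l => ⟨d.1.2 l, d.2.2 l⟩⟩
      invFun := fun d => ⟨(d.1.1, fun l => (d.2 l).1), d.1.2, fun l => (d.2 l).2⟩
      left_inv := fun _ => rfl
      right_inv := fun _ => rfl }
  rw [Nat.card_congr e, Nat.card_sigma]
  have h (θ : {θ : S ⟶ T // T.tree.root ∈ (image θ).edges}) :
      Nat.card (∀ l, {ζ : (x l).rep.of ⟶ T // image ζ = T.tree.ideal (θ.1.fA l.1)}) =
        if leafClass θ.1 = x then ∏ l, autCard (x l) else 0 := by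
    rw [Nat.card_pi]
    simp_rw [← Nat.card_congr (imageEquiv _ T _), card_iso_rep]
    split_ifs with h
    · exact Finset.prod_congr rfl fun l _ => if_pos (congrFun h l).symm
    · obtain ⟨l, hl⟩ := Function.ne_iff.1 h
      exact Finset.prod_eq_zero (Finset.mem_univ l) (if_neg (Ne.symm hl))
  simp_rw [h]
  rw [← Finset.sum_filter, Finset.sum_const, smul_eq_mul]
  congr 1
  rw [← Fintype.card_subtype, ← Nat.card_eq_fintype_card]
  exact Nat.card_congr (Equiv.subtypeSubtypeEquivSubtypeInter
    (fun θ : S ⟶ T => T.tree.root ∈ (image θ).edges) fun θ => leafClass θ = x)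

/-- The gluing data of a family of classes of trees onto the leaves of a tree. -/
abbrev Gluing (S : PTree P) (x : S.tree.Leaf → Pi0 (Trees P)) :=
  ∀ l, (x l).rep.of.α (x l).rep.of.tree.root ⟶ S.α l.1

include hP in
theorem finite_gluing (S : PTree P) (x : S.tree.Leaf → Pi0 (Trees P)) : Finite (Gluing S x) := by
  have := finite_colour_hom hP
  infer_instance

-- The second count of decompositions, by `decompEquiv`: a gluing with result `t` comes with a
-- torsor of isomorphisms to `t`.
include hP in
theorem card_decomp_rep (S : PTree P) (t : Pi0 (Trees P)) (x : S.tree.Leaf → Pi0 (Trees P)) :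
    Nat.card (Decomp S (fun l => (x l).rep.of) t.rep.of) =
      Nat.card {g : Gluing S x // Pi0.mk (⟨graft g⟩ : Trees P) = t} * autCard t := by
  classical
  have := finite_gluing hP S x
  have := Fintype.ofFinite (Gluing S x)
  have := finite_iso hP
  rw [← Nat.card_congr (decompEquiv S (fun l => (x l).rep.of) t.rep.of), Nat.card_sigma]
  simp_rw [card_iso]
  rw [← Finset.sum_filter, Finset.sum_const, smul_eq_mul]
  congr 1
  rw [← Fintype.card_subtype, ← Nat.card_eq_fintype_card]
  refine Nat.card_congr (Equiv.subtypeEquivRight fun g => ?_)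
  rw [show (⟨t.rep.of⟩ : Trees P) = t.rep from rfl, Pi0.mk_rep]

include hP in
theorem card_embeddings_eq_sum (S T : PTree P) (d : Mon P) :
    Nat.card {θ : S ⟶ T // T.tree.root ∈ (image θ).edges ∧ familyMon (leafClass θ) = d} =
      ∑ x ∈ (finite_familyMon_eq (ι := S.tree.Leaf) d).toFinset,
        Nat.card {θ : S ⟶ T // T.tree.root ∈ (image θ).edges ∧ leafClass θ = x} := by
  have := finite_embedding hP
  rw [← Finset.sum_coe_sort, ← Nat.card_sigma]
  refine Nat.card_congr
    { toFun := fun θ => ⟨⟨leafClass θ.1, by simpa using θ.2.2⟩, θ.1, θ.2.1, rfl⟩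
      invFun := fun x => ⟨x.2.1, x.2.2.1, by
        rw [x.2.2.2]
        have h : x.1.1 ∈ {x | familyMon x = d} := (Set.Finite.mem_toFinset _).1 x.1.2
        exact h⟩
      left_inv := fun _ => rfl
      right_inv := ?_ }
  rintro ⟨⟨x, hx⟩, θ, h, h'⟩
  obtain rfl : leafClass θ = x := h'
  rfl

include hP in
/-- The weighted number of cuts of a tree, as a sum over the graftings isomorphic to it. -/
theorem card_cutsOf_div (y t : Pi0 (Trees P)) (d : Mon P) :
    (Nat.card (CutsOf t.rep.of y d) : ℚ) / autCard t =
      (∑ x ∈ (finite_familyMon_eq (ι := y.rep.of.tree.Leaf) d).toFinset,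
        (Nat.card {g : Gluing y.rep.of x // Pi0.mk (⟨graft g⟩ : Trees P) = t} : ℚ) /
          ∏ l, (autCard (x l) : ℚ)) / autCard y := by
  have ht : (autCard t : ℚ) ≠ 0 := Nat.cast_ne_zero.2 (autCard_ne_zero hP t)
  have hy : (autCard y : ℚ) ≠ 0 := Nat.cast_ne_zero.2 (autCard_ne_zero hP y)
  have h := card_cutsOf_mul hP y.rep.of t.rep.of d
  rw [show (⟨y.rep.of⟩ : Trees P) = y.rep from rfl, Pi0.mk_rep, card_embeddings_eq_sum hP] at h
  have h' := congrArg (Nat.cast : ℕ → ℚ) h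
  rw [Nat.cast_mul] at h'
  change _ * (autCard y : ℚ) = _ at h'
  rw [eq_div_iff hy, div_mul_eq_mul_div, h', div_eq_iff ht, Finset.sum_mul]
  push_cast
  refine Finset.sum_congr rfl fun x _ => ?_
  have hx : ∏ l, (autCard (x l) : ℚ) ≠ 0 :=
    Finset.prod_ne_zero_iff.2 fun l _ => Nat.cast_ne_zero.2 (autCard_ne_zero hP _)
  rw [div_mul_eq_mul_div, eq_div_iff hx]
  -- The two counts of the decompositions of `t` are equated.
  exact_mod_cast (card_decomp_eq_mul hP _ _ x).symm.trans (card_decomp_rep hP _ _ x)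

-- Such a `t` is a grafting onto the representative of `y` of one of finitely many families, along
-- one of finitely many gluings.
include hP in
theorem finite_cutsOf_nonempty (y : Pi0 (Trees P)) (d : Mon P) :
    {t : Pi0 (Trees P) | Nat.card (CutsOf t.rep.of y d) ≠ 0}.Finite := by
  have := finite_gluing hP
  refine ((finite_familyMon_eq (ι := y.rep.of.tree.Leaf) d).biUnion fun x _ =>
    Set.finite_range fun g : Gluing y.rep.of x => Pi0.mk (⟨graft g⟩ : Trees P)).subset ?_
  intro t ht
  by_contra hn
  simp only [Set.mem_iUnion, not_exists] at hn
  have h := card_cutsOf_div hP y t d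
  rw [Finset.sum_eq_zero, zero_div, div_eq_zero_iff] at h
  · rcases h with h | h
    · exact ht (Nat.cast_eq_zero.1 h)
    · exact autCard_ne_zero hP t (Nat.cast_eq_zero.1 h)
  · intro x hx
    have : IsEmpty {g : Gluing y.rep.of x // Pi0.mk (⟨graft g⟩ : Trees P) = t} :=
      ⟨fun g => hn x (by simpa using hx) ⟨g.1, g.2⟩⟩
    simp

/-- The number of isomorphisms from the root colour of a tree to a given colour. -/
noncomputable def rootHomCard (w : I) (x : Pi0 (Trees P)) : ℕ :=
  Nat.card ((rootMap P).obj x.rep ⟶ w)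

include hP in
/-- The weighted number of all cuts with a given class below and a given monomial above. -/
theorem finsum_card_cutsOf_div (y : Pi0 (Trees P)) (d : Mon P) :
    ∑ᶠ t : Pi0 (Trees P), (Nat.card (CutsOf t.rep.of y d) : ℚ) / autCard t =
      (∑ x ∈ (finite_familyMon_eq (ι := y.rep.of.tree.Leaf) d).toFinset,
        ∏ l, (rootHomCard (y.rep.of.α l.1) (x l) : ℚ) / autCard (x l)) / autCard y := by
  classical
  have := finite_gluing hP
  have hfin (x : y.rep.of.tree.Leaf → Pi0 (Trees P)) : {t : Pi0 (Trees P) |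
      Nat.card {g : Gluing y.rep.of x // Pi0.mk (⟨graft g⟩ : Trees P) = t} ≠ 0}.Finite := by
    refine (Set.finite_range fun g : Gluing y.rep.of x =>
      Pi0.mk (⟨graft g⟩ : Trees P)).subset fun t ht => ?_
    obtain ⟨⟨g, hg⟩⟩ := (Nat.card_ne_zero.1 ht).1
    exact ⟨g, hg⟩
  have hfin' (x : y.rep.of.tree.Leaf → Pi0 (Trees P)) : (Function.support fun t =>
      (Nat.card {g : Gluing y.rep.of x // Pi0.mk (⟨graft g⟩ : Trees P) = t} : ℚ) /
          ∏ l, (autCard (x l) : ℚ)).Finite := by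
    refine (hfin x).subset fun t ht h => ht ?_
    simp only [h, Nat.cast_zero, zero_div]
  simp_rw [card_cutsOf_div hP y, div_eq_mul_inv _ (autCard y : ℚ)]
  rw [← finsum_mul, finsum_sum_comm _ _ fun x _ => hfin' x]
  congr 1
  refine Finset.sum_congr rfl fun x _ => ?_
  simp_rw [div_eq_mul_inv _ (∏ l, (autCard (x l) : ℚ))]
  rw [← finsum_mul, ← div_eq_mul_inv, Finset.prod_div_distrib]
  congr 1
  have := Fintype.ofFinite (Gluing y.rep.of x)
  rw [finsum_eq_sum_of_support_subset (s := (hfin x).toFinset) _ (fun t ht => by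
    simpa using ht)]
  rw [← Nat.cast_sum]
  have h : Nat.card (Gluing y.rep.of x) = ∏ l, rootHomCard (y.rep.of.α l.1) (x l) := Nat.card_pi
  rw [← Nat.cast_prod, ← h]
  congr 1
  simp_rw [Nat.card_eq_fintype_card, Fintype.card_subtype]
  rw [← Finset.card_univ]
  -- Each gluing has exactly one result, so summing over `t` counts all gluings.
  refine (Finset.card_eq_sum_card_fiberwise fun g _ => ?_).symm
  simp only [Set.Finite.coe_toFinset, Set.mem_ofPred_eq]
  exact Finset.card_ne_zero.2 ⟨g, by simp⟩

end Counting

end TreeBialgebra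

/-! ### Homotopy fibres and quotients: discreteness, orbit counting, full faithfulness -/

namespace TreeBialgebra

open CategoryTheory

section Groupoid

/-- A category without non-trivial endomorphisms whose isomorphism classes are separated by a
function with finite range is a finite groupoid, whose cardinality is that of the range. -/
theorem isFiniteGroupoid_of_separating {C : Type u} [Category.{v} C] {Φ : Type u₁} [Finite Φ]
    (val : C → Φ) (h : ∀ x y : C, Subsingleton (x ⟶ y))
    (hval : ∀ x y : C, Nonempty (x ≅ y) ↔ val x = val y) :
    IsFiniteGroupoid C ∧ groupoidCard C = Nat.card (Set.range val) := by
  let e : Pi0 C ≃ Set.range val := Equiv.ofBijective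
    (Quotient.lift (fun x => ⟨val x, x, rfl⟩) fun x y hxy => Subtype.ext ((hval x y).1 hxy)) <| by
    constructor
    · rintro ⟨x⟩ ⟨y⟩ hxy
      exact (Pi0.mk_eq_mk_iff x y).2 ((hval x y).2 (congrArg Subtype.val hxy))
    · rintro ⟨_, x, rfl⟩
      exact ⟨Pi0.mk x, rfl⟩
  have hA (x : C) : Subsingleton (Aut x) := ⟨fun f g => Iso.ext (Subsingleton.elim _ _)⟩
  have : Finite (Pi0 C) := Finite.of_equiv _ e.symm
  refine ⟨⟨this, fun x => inferInstance⟩, ?_⟩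
  have := Fintype.ofFinite (Pi0 C)
  have h1 (x : C) : Nat.card (Aut x) = 1 := Nat.card_eq_one_iff_unique.2 ⟨hA x, ⟨Iso.refl x⟩⟩
  simp only [groupoidCard, h1, finsum_eq_sum_of_fintype]
  rw [← Nat.card_congr e, Nat.card_eq_fintype_card]
  simp

variable {X : Type u} [Groupoid.{v} X] {J : Type u₁} [Groupoid.{v₁} J]

instance (F : X ⥤ J) (b : J) : IsGroupoid (CostructuredArrow F b) :=
  isGroupoid_of_reflects_iso (CostructuredArrow.proj F b)

/-- The invariant of an object of the homotopy fibre over `T` of the projection from the homotopy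
fibre of `F` over `b`. -/
def fibreVal (F : X ⥤ J) (b : J) (T : X) (o : CostructuredArrow (CostructuredArrow.proj F b) T) :
    F.obj T ⟶ b :=
  F.map (Groupoid.inv o.hom) ≫ o.left.hom

/-- An arrow between objects over `T` is determined by their structure maps to `T`, which are
invertible. -/
theorem fibre_subsingleton (F : X ⥤ J) (b : J) (T : X)
    (o o' : CostructuredArrow (CostructuredArrow.proj F b) T) : Subsingleton (o ⟶ o') := by
  refine ⟨fun f g => ?_⟩
  have hf : f.left.left ≫ o'.hom = o.hom := CostructuredArrow.w f
  have hg : g.left.left ≫ o'.hom = o.hom := CostructuredArrow.w g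
  ext
  exact (cancel_mono o'.hom).1 (hf.trans hg.symm)

theorem map_inv_comp_congr (F : X ⥤ J) {b : J} {x x' T : X} {f : x ⟶ T} {f' : x' ⟶ T} {k : x ⟶ x'}
    {φ : F.obj x ⟶ b} {φ' : F.obj x' ⟶ b} (h : k ≫ f' = f) (h' : F.map k ≫ φ' = φ) :
    F.map (Groupoid.inv f) ≫ φ = F.map (Groupoid.inv f') ≫ φ' := by
  subst h h'
  simp [Groupoid.inv_eq_inv]

theorem map_comp_inv_comp (F : X ⥤ J) {b : J} {x x' T : X} {f : x ⟶ T} {f' : x' ⟶ T}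
    {φ : F.obj x ⟶ b} {φ' : F.obj x' ⟶ b}
    (h : F.map (Groupoid.inv f) ≫ φ = F.map (Groupoid.inv f') ≫ φ') :
    F.map (f ≫ Groupoid.inv f') ≫ φ' = φ := by
  rw [Functor.map_comp, Category.assoc, ← h]
  simp [Groupoid.inv_eq_inv]

/-- Transporting an object to `T` along its structure map leaves only an arrow `F.obj T ⟶ b`; the
double fibre is thus a discrete set of such arrows. -/
theorem nonempty_fibre_iso_iff (F : X ⥤ J) (b : J) (T : X)
    (o o' : CostructuredArrow (CostructuredArrow.proj F b) T) :
    Nonempty (o ≅ o') ↔ fibreVal F b T o = fibreVal F b T o' := by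
  constructor
  · rintro ⟨f⟩
    have hf : f.hom.left.left ≫ o'.hom = o.hom := CostructuredArrow.w f.hom
    have hf' : F.map f.hom.left.left ≫ o'.left.hom = o.left.hom := CostructuredArrow.w f.hom.left
    exact map_inv_comp_congr F hf hf'
  · intro h
    refine ⟨CostructuredArrow.isoMk (CostructuredArrow.isoMk
      ((Groupoid.isoEquivHom _ _).symm (o.hom ≫ Groupoid.inv o'.hom)) ?_) ?_⟩
    · exact map_comp_inv_comp F h
    · exact (Category.assoc _ _ _).trans
        ((congrArg (o.hom ≫ ·) (Groupoid.inv_comp o'.hom)).trans (Category.comp_id _))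

/-- The homotopy fibres over `X` of a full subgroupoid of a homotopy fibre of `F : X ⥤ J`. -/
theorem isFiniteGroupoid_fibre (F : X ⥤ J) (b : J) (T : X) [Finite (F.obj T ⟶ b)]
    {C : Type u₂} [Category.{v₂} C] (K : C ⥤ CostructuredArrow F b) [K.Full] [K.Faithful] :
    IsFiniteGroupoid (CostructuredArrow (K ⋙ CostructuredArrow.proj F b) T) ∧
      groupoidCard (CostructuredArrow (K ⋙ CostructuredArrow.proj F b) T) =
        Nat.card (Set.range fun o => fibreVal F b T
          ((CostructuredArrow.pre K (CostructuredArrow.proj F b) T).obj o)) := by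
  refine isFiniteGroupoid_of_separating _ (fun o o' => ?_) fun o o' => ?_
  · have := fibre_subsingleton F b T
      ((CostructuredArrow.pre K (CostructuredArrow.proj F b) T).obj o)
      ((CostructuredArrow.pre K (CostructuredArrow.proj F b) T).obj o')
    exact ((CostructuredArrow.pre K (CostructuredArrow.proj F b) T).map_injective).subsingleton
  · rw [← nonempty_fibre_iso_iff]
    exact ⟨fun ⟨f⟩ => ⟨Functor.mapIso _ f⟩, fun ⟨f⟩ => ⟨Functor.preimageIso _ f⟩⟩

theorem sigma_fibre_ext {F : X ⥤ J} {b : J} {T : X} {Z : CostructuredArrow F b}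
    (p q : Σ φ : F.obj T ⟶ b, (CostructuredArrow.mk φ ⟶ Z)) (h : p.2.left = q.2.left) : p = q := by
  obtain ⟨φ, f⟩ := p
  obtain ⟨ψ, g⟩ := q
  have hf : F.map f.left ≫ Z.hom = φ := CostructuredArrow.w f
  have hg : F.map g.left ≫ Z.hom = ψ := CostructuredArrow.w g
  have h' : f.left = g.left := h
  obtain rfl : φ = ψ := by rw [← hf, ← hg, h']
  exact Sigma.ext rfl (heq_of_eq (CostructuredArrow.hom_ext _ _ h))

open Classical in
/-- Orbit counting: the objects of the homotopy fibre of `F` over `b` lying over the class of `T`,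
weighted by the inverses of the orders of their vertex groups. -/
theorem finsum_fibre_inv_card (F : X ⥤ J) (b : J) (T : X) [Finite (F.obj T ⟶ b)]
    (hfin : ∀ x : X, Finite (Aut x)) :
    ∑ᶠ y : Pi0 (CostructuredArrow F b),
      (if Pi0.mk ((CostructuredArrow.proj F b).obj y.rep) = Pi0.mk T then
        1 / (Nat.card (Aut y.rep) : ℚ) else 0) =
      (Nat.card (F.obj T ⟶ b) : ℚ) / Nat.card (Aut T) := by
  have := Fintype.ofFinite (F.obj T ⟶ b)
  let cls : (F.obj T ⟶ b) → Pi0 (CostructuredArrow F b) := fun φ => Pi0.mk (CostructuredArrow.mk φ)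
  have hT : (Nat.card (Aut T) : ℚ) ≠ 0 :=
    Nat.cast_ne_zero.2 (Nat.card_ne_zero.2 ⟨⟨Iso.refl T⟩, hfin T⟩)
  have hfinA (y : CostructuredArrow F b) : Finite (Aut y) := by
    have := hfin y.left
    refine Finite.of_injective
      (fun f : Aut y => (show Aut y.left from (CostructuredArrow.proj F b).mapIso f))
      fun f g h => Iso.ext ?_
    exact (CostructuredArrow.proj F b).map_injective (congrArg Iso.hom h)
  -- An arrow from the underlying object of `y` to `T` transports the structure map of `y` to some
  -- `φ`, and its inverse becomes an arrow from `φ` to `y`. Each `φ` in the class of `y` receives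
  -- `|Aut y|` of these arrows.
  have key (y : Pi0 (CostructuredArrow F b)) :
      Nat.card (y.rep.left ⟶ T) = (Finset.univ.filter fun φ => cls φ = y).card *
        Nat.card (Aut y.rep) := by
    let e : (y.rep.left ⟶ T) ≃ Σ φ : F.obj T ⟶ b, (CostructuredArrow.mk φ ⟶ y.rep) :=
      { toFun := fun f => ⟨F.map (Groupoid.inv f) ≫ y.rep.hom,
          CostructuredArrow.homMk (Groupoid.inv f) rfl⟩
        invFun := fun x => Groupoid.inv x.2.left
        left_inv := fun f => by simp [Groupoid.inv_eq_inv]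
        right_inv := by
          rintro ⟨φ, f⟩
          exact sigma_fibre_ext _ _ (by simp [Groupoid.inv_eq_inv]) }
    have hfin2 (φ : F.obj T ⟶ b) : Finite (CostructuredArrow.mk φ ⟶ y.rep) := by
      have := hfinA y.rep
      exact finite_hom_of_finite_aut
    rw [Nat.card_congr e, Nat.card_sigma]
    simp_rw [card_hom_eq, Pi0.mk_rep]
    rw [← Finset.sum_filter, Finset.sum_const, smul_eq_mul]
  have term (y : Pi0 (CostructuredArrow F b)) :
      (if Pi0.mk ((CostructuredArrow.proj F b).obj y.rep) = Pi0.mk T then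
        1 / (Nat.card (Aut y.rep) : ℚ) else 0) =
      ((Finset.univ.filter fun φ => cls φ = y).card : ℚ) * (Nat.card (Aut T) : ℚ)⁻¹ := by
    have hy : (Nat.card (Aut y.rep) : ℚ) ≠ 0 :=
      Nat.cast_ne_zero.2 (Nat.card_ne_zero.2 ⟨⟨Iso.refl _⟩, hfinA y.rep⟩)
    have h := key y
    rw [card_hom_eq] at h
    change (if Pi0.mk y.rep.left = Pi0.mk T then _ else _) = _
    split_ifs at h ⊢
    · rw [← div_eq_mul_inv, div_eq_div_iff hy hT, one_mul]
      exact_mod_cast h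
    · obtain h | h := mul_eq_zero.1 h.symm
      · rw [h]; simp
      · exact absurd h (Nat.cast_ne_zero.1 hy)
  simp_rw [term]
  rw [← finsum_mul, div_eq_mul_inv]
  congr 1
  rw [finsum_eq_sum_of_support_subset (s := Finset.univ.image cls), ← Nat.cast_sum,
    Nat.card_eq_fintype_card, ← Finset.card_univ]
  · congr 1
    exact (Finset.card_eq_sum_card_fiberwise fun φ _ => by simp).symm
  · intro y hy
    rw [Function.mem_support, Nat.cast_ne_zero, Finset.card_ne_zero] at hy
    obtain ⟨φ, hφ⟩ := hy
    simp only [Finset.mem_filter, Finset.mem_univ, true_and] at hφ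
    simp only [Finset.coe_image, Finset.coe_univ, Set.image_univ, Set.mem_range]
    exact ⟨φ, hφ⟩

/-- As `J` is a groupoid, `Aut b` viewed as a one-object category is a full subcategory of it. Full
faithfulness passes to the comma projection, so the homotopy quotient of a fibre is equivalent to
the full subcategory of objects lying over the class of `b`. -/
instance (b : J) : (SingleObj.functor (Aut.toEnd b)).Faithful where
  map_injective h := Iso.ext h

instance (b : J) : (SingleObj.functor (Aut.toEnd b)).Full where
  map_surjective f := ⟨(Groupoid.isoEquivHom b b).symm f, rfl⟩

variable {D : Type u₂} [Category.{v₂} D] {A : Type u₃} [Category.{v₃} A]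

instance (p : D ⥤ J) (q : A ⥤ J) [q.Faithful] : (Comma.fst p q).Faithful where
  map_injective {x y} f g h := by
    refine Comma.hom_ext _ _ h (q.map_injective ((cancel_epi x.hom).1 ?_))
    have h' : f.left = g.left := h
    rw [← f.w, ← g.w, h']

instance (p : D ⥤ J) (q : A ⥤ J) [q.Full] : (Comma.fst p q).Full where
  map_surjective {x y} f := by
    obtain ⟨k, hk⟩ := q.map_surjective (Groupoid.inv x.hom ≫ p.map f ≫ y.hom)
    exact ⟨⟨f, k, by rw [hk]; simp [Groupoid.inv_eq_inv]⟩, rfl⟩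

instance (p : D ⥤ J) (q : A ⥤ J) :
    (CostructuredArrow.grothendieckPrecompFunctorToComma p q).IsEquivalence :=
  (CostructuredArrow.grothendieckPrecompFunctorEquivalence p q).isEquivalence_functor

instance (p : D ⥤ J) (b : J) : (FibreQuotient.proj p b).Full := by
  unfold FibreQuotient.proj; infer_instance

instance (p : D ⥤ J) (b : J) : (FibreQuotient.proj p b).Faithful := by
  unfold FibreQuotient.proj; infer_instance

end Groupoid

variable {I : Type u₁} [Groupoid.{v₁} I] {E : Type u₂} [Groupoid.{v₂} E]
  {B : Type u₃} [Groupoid.{v₃} B] {P : PolyDiagram I E B}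

/-! ### Coefficients of the Green functions -/

section Green

variable (hP : ∀ T : Trees P, Finite (Aut T))

include hP in
theorem isFiniteMorphism_treesOverProj (w : I) : IsFiniteMorphism (treesOverProj P w) := fun T => by
  have := finite_colour_hom hP
  exact (isFiniteGroupoid_fibre (rootMap P) w T (𝟭 _)).1

include hP in
theorem isFiniteMorphism_summandProj (N : Fam I) (v : I) :
    IsFiniteMorphism (summandProj P N v) := fun T => by
  have := finite_colour_hom hP
  exact (isFiniteGroupoid_fibre (rootMap P) v T (FibreQuotient.proj (leafMapOver P v) N)).1

-- The quotient being fully faithful over T_v, its fibre over `x` is a set of arrows from the root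
-- colour to `v`; only the leaves decide whether it is everything or empty.
open Classical in
include hP in
theorem relCard_summandProj (N : Fam I) (v : I) (x : Pi0 (Trees P)) :
    relCard (summandProj P N v) x =
      if Nonempty ((leafMap P).obj x.rep ⟶ N) then (rootHomCard v x : ℚ) / autCard x else 0 := by
  have := finite_colour_hom hP
  have h := (isFiniteGroupoid_fibre (rootMap P) v x.rep
    (FibreQuotient.proj (leafMapOver P v) N)).2
  have h2 : relCard (summandProj P N v) x = _ / _ := rfl
  rw [h2]
  erw [h]
  split_ifs with hN
  · obtain ⟨l⟩ := hN
    refine congrArg (fun k : ℕ => (k : ℚ) / _) ?_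
    refine Nat.card_congr ((Equiv.setCongr (Set.eq_univ_of_forall fun φ => ?_)).trans
      (Equiv.Set.univ _))
    -- Any `φ` makes `x.rep` an object of T_v, `l` places it over `N`, and the identity of `x.rep`
    -- then has invariant `φ`.
    let o : FibreQuotient (leafMapOver P v) N :=
      ⟨SingleObj.star _, CostructuredArrow.mk (Y := CostructuredArrow.mk φ) l⟩
    refine ⟨CostructuredArrow.mk (Y := o) (𝟙 x.rep), ?_⟩
    refine Eq.trans (congrArg (· ≫ φ) ?_) (Category.id_comp φ)
    exact (congrArg (rootMap P).map
      (show Groupoid.inv (𝟙 x.rep) = 𝟙 x.rep by simp [Groupoid.inv_eq_inv])).trans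
      ((rootMap P).map_id x.rep)
  · have : IsEmpty (CostructuredArrow (FibreQuotient.proj (leafMapOver P v) N ⋙
        CostructuredArrow.proj (rootMap P) v) x.rep) :=
      ⟨fun o => hN ⟨(leafMap P).map (Groupoid.inv o.hom) ≫ o.left.fiber.hom⟩⟩
    rw [Set.range_eq_empty]
    simp

open Classical in
theorem coeff_linearSeries (a : Pi0 (Trees P) → ℚ) (m : Mon P) :
    MvPowerSeries.coeff m (linearSeries a) =
      ∑ᶠ x : Pi0 (Trees P), if m = Finsupp.single x 1 then a x else 0 := rfl

theorem coeff_linearSeries_single (a : Pi0 (Trees P) → ℚ) (x : Pi0 (Trees P)) :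
    MvPowerSeries.coeff (Finsupp.single x 1) (linearSeries a) = a x := by
  rw [coeff_linearSeries, finsum_eq_single _ x]
  · simp
  · intro y hy
    rw [if_neg]
    exact fun h => hy (Finsupp.single_left_injective one_ne_zero h).symm

theorem coeff_linearSeries_eq_zero (a : Pi0 (Trees P) → ℚ) {m : Mon P}
    (hm : ∀ x, m ≠ Finsupp.single x 1) : MvPowerSeries.coeff m (linearSeries a) = 0 := by
  rw [coeff_linearSeries]
  simp [hm]

include hP in
theorem green_eq (v : I) :
    green P v = linearSeries fun x => (rootHomCard v x : ℚ) / autCard x := by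
  have := finite_colour_hom hP
  unfold green
  congr 1
  funext x
  have h := finsum_fibre_inv_card (rootMap P) v x.rep hP
  rw [Pi0.mk_rep] at h
  exact h

end Green

end TreeBialgebra

/-! ### Coefficients of the comultiplication and its extension to power series -/

namespace TreeBialgebra

open CategoryTheory

variable {I : Type u₁} [Groupoid.{v₁} I] {E : Type u₂} [Groupoid.{v₂} E]
  {B : Type u₃} [Groupoid.{v₃} B] {P : PolyDiagram I E B}

section Comul

open scoped TensorProduct

noncomputable instance (T : OpTree) : Fintype T.Cut := Fintype.ofFinite _

/-- The monomial of the forest above a cut. -/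
noncomputable def cutUpper {T : PTree P} (c : T.tree.Cut) : Mon P :=
  familyMon fun l : c.1.toTree.Leaf => idealClass T l.1.1

/-- The class of the tree below a cut. -/
def cutLower {T : PTree P} (c : T.tree.Cut) : Pi0 (Trees P) := Pi0.mk ⟨T.restrict c.1⟩

theorem forestMonomial_eq (F : Forests P) :
    forestMonomial F = MvPolynomial.monomial (familyMon fun i => Pi0.mk (F.obj i)) 1 := by
  have := Fintype.ofFinite F.ι
  rw [forestMonomial, familyMon, finprod_eq_prod_of_fintype, finsum_eq_sum_of_fintype,
    MvPolynomial.monomial_sum_one]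
  rfl

theorem comul_X (x : Pi0 (Trees P)) :
    comul P (MvPolynomial.X x) = ∑ c : x.rep.of.tree.Cut,
      MvPolynomial.monomial (cutUpper c) (1 : ℚ) ⊗ₜ[ℚ]
        MvPolynomial.monomial (Finsupp.single (cutLower c) 1) (1 : ℚ) := by
  rw [comul, MvPolynomial.aeval_X, finsum_eq_sum_of_fintype]
  refine Finset.sum_congr rfl fun c _ => ?_
  rw [forestMonomial_eq]
  rfl

theorem tensorCoeff_tmul (d : Mon P × Mon P) (a b : TreeAlg P) :
    tensorCoeff d (a ⊗ₜ[ℚ] b) = MvPolynomial.coeff d.1 a * MvPolynomial.coeff d.2 b := by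
  simp [tensorCoeff]

open Classical in
theorem tensorCoeff_mul_monomial (d : Mon P × Mon P) (p q : Mon P)
    (z : TreeAlg P ⊗[ℚ] TreeAlg P) :
    tensorCoeff d (z * MvPolynomial.monomial p (1 : ℚ) ⊗ₜ[ℚ] MvPolynomial.monomial q (1 : ℚ)) =
      if p ≤ d.1 ∧ q ≤ d.2 then tensorCoeff (d.1 - p, d.2 - q) z else 0 := by
  induction z using TensorProduct.induction_on with
  | zero => simp
  | tmul a b =>
    rw [Algebra.TensorProduct.tmul_mul_tmul, tensorCoeff_tmul, tensorCoeff_tmul,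
      MvPolynomial.coeff_mul_monomial', MvPolynomial.coeff_mul_monomial']
    by_cases h1 : p ≤ d.1 <;> by_cases h2 : q ≤ d.2 <;> simp [h1, h2]
  | add a b ha hb =>
    rw [add_mul, map_add, ha, hb]
    split_ifs <;> simp

open Classical in
theorem tensorCoeff_comul_X (d : Mon P × Mon P) (x : Pi0 (Trees P)) :
    tensorCoeff d (comul P (MvPolynomial.X x)) = ∑ c : x.rep.of.tree.Cut,
      if Finsupp.single (cutLower c) 1 = d.2 ∧ cutUpper c = d.1 then 1 else 0 := by
  rw [comul_X, map_sum]
  refine Finset.sum_congr rfl fun c _ => ?_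
  rw [tensorCoeff_tmul, MvPolynomial.coeff_monomial, MvPolynomial.coeff_monomial]
  by_cases h1 : cutUpper c = d.1 <;> by_cases h2 : Finsupp.single (cutLower c) 1 = d.2 <;>
    simp [h1, h2]

theorem tensorCoeff_comul_X_single (d : Mon P) (y x : Pi0 (Trees P)) :
    tensorCoeff (d, Finsupp.single y 1) (comul P (MvPolynomial.X x)) =
      Nat.card (CutsOf x.rep.of y d) := by
  classical
  rw [tensorCoeff_comul_X, Finset.sum_boole, CutsOf, Nat.card_eq_fintype_card,
    Fintype.card_subtype]
  congr 2
  refine Finset.filter_congr fun c _ => ?_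
  rw [(Finsupp.single_left_injective one_ne_zero).eq_iff]
  rfl

theorem tensorCoeff_comul_X_eq_zero (d : Mon P × Mon P) (hd : ∀ y, d.2 ≠ Finsupp.single y 1)
    (x : Pi0 (Trees P)) : tensorCoeff d (comul P (MvPolynomial.X x)) = 0 := by
  classical
  rw [tensorCoeff_comul_X]
  exact Finset.sum_eq_zero fun c _ => if_neg fun h => hd _ h.1.symm

/-- The degree and the variables of a monomial whose coproduct has a given coefficient. -/
theorem degree_and_support_of_tensorCoeff_ne_zero (k : ℕ) (m : Mon P) (hm : m.degree = k)
    (d : Mon P × Mon P) (h : tensorCoeff d (comul P (MvPolynomial.monomial m 1)) ≠ 0) :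
    k = d.2.degree ∧ ∀ x ∈ m.support, ∃ c : x.rep.of.tree.Cut,
      cutUpper c ≤ d.1 ∧ Finsupp.single (cutLower c) 1 ≤ d.2 := by
  classical
  induction k generalizing m d with
  | zero =>
    obtain rfl := (Finsupp.degree_eq_zero_iff m).1 hm
    refine ⟨?_, by simp⟩
    have h1 : comul P (MvPolynomial.monomial 0 1) = 1 := map_one _
    rw [h1, Algebra.TensorProduct.one_def, tensorCoeff_tmul] at h
    have h2 := right_ne_zero_of_mul h
    rw [MvPolynomial.coeff_one] at h2
    rw [← of_not_not fun h' => h2 (if_neg h')]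
    simp
  | succ k ih =>
    have hm0 : m ≠ 0 := by
      rintro rfl
      simp at hm
    obtain ⟨x, hx⟩ := Finsupp.support_nonempty_iff.2 hm0
    -- One variable is split off: every term of its coproduct has degree exactly one in the second
    -- factor, so the degree of `d.2` drops by one.
    obtain ⟨m', rfl⟩ : ∃ m', m = m' + Finsupp.single x 1 := by
      refine ⟨m - Finsupp.single x 1, (tsub_add_cancel_of_le ?_).symm⟩
      exact Finsupp.single_le_iff.2 (Nat.one_le_iff_ne_zero.2 (Finsupp.mem_support_iff.1 hx))
    have hm' : m'.degree = k := by simpa using hm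
    have h1 : (MvPolynomial.monomial (m' + Finsupp.single x 1) (1 : ℚ)) =
        MvPolynomial.monomial m' 1 * MvPolynomial.X x := by
      rw [MvPolynomial.X, MvPolynomial.monomial_mul, one_mul]
    rw [h1, map_mul, comul_X, Finset.mul_sum, map_sum] at h
    obtain ⟨c, _, hc⟩ := Finset.exists_ne_zero_of_sum_ne_zero h
    rw [tensorCoeff_mul_monomial] at hc
    split_ifs at hc with hle
    · obtain ⟨h2, h3⟩ := ih m' hm' _ hc
      obtain ⟨hle1, hle2⟩ := hle
      constructor
      · rw [h2, ← tsub_add_cancel_of_le hle2, map_add]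
        simp
      · intro z hz
        by_cases hzx : z = x
        · subst hzx
          exact ⟨c, hle1, hle2⟩
        · have hz' : z ∈ m'.support := by
            rw [Finsupp.mem_support_iff] at hz ⊢
            simpa [Finsupp.single_apply, Ne.symm hzx] using hz
          obtain ⟨c', h4, h5⟩ := h3 z hz'
          exact ⟨c', h4.trans tsub_le_self, h5.trans tsub_le_self⟩
    · exact absurd rfl hc

/-- The degree of `m` is that of `d.2`, and each variable of `m` has a cut whose two monomials
divide those of `d`; `finite_cutsOf_nonempty` leaves finitely many such variables. -/
theorem comulExtends (hP : ∀ T : Trees P, Finite (Aut T)) : ComulExtends P := by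
  classical
  intro d
  have hfin : (⋃ q ∈ Set.Iic d.1, ⋃ y ∈ (d.2.support : Set (Pi0 (Trees P))),
      {t : Pi0 (Trees P) | Nat.card (CutsOf t.rep.of y q) ≠ 0}).Finite :=
    (Set.finite_Iic d.1).biUnion fun q _ => d.2.support.finite_toSet.biUnion fun y _ =>
      finite_cutsOf_nonempty hP y q
  -- No exponent exceeds the degree, so every such `m` divides this one monomial.
  refine (Set.finite_Iic (∑ x ∈ hfin.toFinset, Finsupp.single x d.2.degree)).subset ?_
  intro m hm
  obtain ⟨hdeg, hsupp⟩ := degree_and_support_of_tensorCoeff_ne_zero _ m rfl d hm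
  intro x
  by_cases hx : x ∈ m.support
  · obtain ⟨c, hc, hc'⟩ := hsupp x hx
    have hmem : x ∈ hfin.toFinset := by
      rw [Set.Finite.mem_toFinset]
      simp only [Set.mem_iUnion]
      refine ⟨cutUpper c, hc, cutLower c, ?_, ?_⟩
      · have := Finsupp.single_le_iff.1 hc'
        rw [Finset.mem_coe, Finsupp.mem_support_iff]
        omega
      · have : Finite (CutsOf x.rep.of (cutLower c) (cutUpper c)) := by
          unfold CutsOf; infer_instance
        exact Nat.card_ne_zero.2 ⟨⟨⟨c, rfl, rfl⟩⟩, this⟩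
    rw [Finsupp.finsetSum_apply]
    calc m x ≤ Finsupp.single x d.2.degree x := by
          rw [Finsupp.single_eq_same, ← hdeg]
          exact Finsupp.le_degree x m
      _ ≤ _ := Finset.single_le_sum (f := fun y => Finsupp.single y d.2.degree x)
          (fun _ _ => Nat.zero_le _) hmem
  · rw [Finsupp.notMem_support_iff.1 hx]
    exact Nat.zero_le _

end Comul

/-! ### Products and coproducts of series linear in the trees -/

section Series

/-- Each factor contributes one variable, so only factorisations of `d` into single variables
matter, and these are the families of classes with monomial `d`. -/
theorem coeff_prod_linearSeries {ι : Type} [Fintype ι] (a : ι → Pi0 (Trees P) → ℚ) (d : Mon P) :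
    MvPowerSeries.coeff d (∏ i, linearSeries (a i)) =
      ∑ x ∈ (finite_familyMon_eq (ι := ι) d).toFinset, ∏ i, a i (x i) := by
  classical
  rw [MvPowerSeries.coeff_prod]
  symm
  refine Finset.sum_of_injOn
    (fun x => Finsupp.equivFunOnFinite.symm fun i => Finsupp.single (x i) 1) ?_ ?_ ?_ ?_
  · intro x _ y _ h
    funext i
    exact Finsupp.single_left_injective one_ne_zero (DFunLike.congr_fun h i)
  · intro x hx
    have hx' : x ∈ {x | familyMon x = d} := (Set.Finite.mem_toFinset _).1 hx
    have hx2 : familyMon x = d := hx'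
    rw [Finset.mem_coe, Finset.mem_finsuppAntidiag]
    refine ⟨?_, Finset.subset_univ _⟩
    rw [← hx2, familyMon, finsum_eq_sum_of_fintype]
    rfl
  · intro l hl hl'
    obtain ⟨hl1, -⟩ := Finset.mem_finsuppAntidiag.1 hl
    by_contra hne
    have h (i : ι) : ∃ x, l i = Finsupp.single x 1 := by
      by_contra hi
      push Not at hi
      exact hne (Finset.prod_eq_zero (Finset.mem_univ i) (coeff_linearSeries_eq_zero _ hi))
    choose x hx using h
    refine hl' ⟨x, (Set.Finite.mem_toFinset _).2 ?_, Finsupp.ext fun i => (hx i).symm⟩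
    change familyMon x = d
    rw [familyMon, finsum_eq_sum_of_fintype, ← hl1]
    exact Finset.sum_congr rfl fun i _ => (hx i).symm
  · intro x _
    exact Finset.prod_congr rfl fun i _ => (coeff_linearSeries_single _ _).symm

theorem comulSeries_linearSeries (a : Pi0 (Trees P) → ℚ) (d : Mon P × Mon P) :
    comulSeries (linearSeries a) d =
      ∑ᶠ x, a x * tensorCoeff d (comul P (MvPolynomial.X x)) := by
  have hinj : Function.Injective fun x : Pi0 (Trees P) => Finsupp.single x 1 :=
    Finsupp.single_left_injective (M := ℕ) one_ne_zero
  have h := finsum_mem_range (f := fun m : Mon P => MvPowerSeries.coeff m (linearSeries a) *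
    tensorCoeff d (comul P (MvPolynomial.monomial m 1))) hinj
  simp only [coeff_linearSeries_single] at h
  refine Eq.trans ?_ h
  rw [finsum_mem_def, comulSeries]
  congr 1
  symm
  rw [Set.indicator_eq_self]
  intro m hm
  by_contra hn
  refine hm ?_
  change MvPowerSeries.coeff m (linearSeries a) * _ = 0
  rw [coeff_linearSeries_eq_zero, zero_mul]
  exact fun x hx => hn ⟨x, hx.symm⟩

end Series

/-! ### Leaf profiles and multiindices -/

section Profile

variable {s : ℕ} {col : Fin s → I} (hcol : Function.Bijective fun i => Pi0.mk (col i))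

include hcol in
theorem exists_hom_profile (N : Fam I) : ∃ n, Nonempty (N ⟶ profile col n) := by
  choose c hc using fun j => hcol.2 (Pi0.mk (N.obj j))
  have h (j : N.ι) : Nonempty (N.obj j ≅ col (c j)) := (Pi0.mk_eq_mk_iff _ _).1 (hc j).symm
  let n : Fin s → ℕ := fun i => Nat.card {j // c j = i}
  let e : N.ι ≃ Σ i, Fin (n i) := (Equiv.sigmaFiberEquiv c).symm.trans
    (Equiv.sigmaCongrRight fun i => Finite.equivFin {j // c j = i})
  exact ⟨n, ⟨⟨e, fun j => (h j).some.hom⟩⟩⟩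

-- The multiindex counts the members of each colour class, so a family has at most one profile; this
-- isolates a single term of the sum over multiindices.
include hcol in
theorem eq_card_of_hom_profile {N : Fam I} {n : Fin s → ℕ} (f : N ⟶ profile col n) (i : Fin s) :
    n i = Nat.card {j : N.ι // Pi0.mk (N.obj j) = Pi0.mk (col i)} := by
  have h (j : N.ι) : Pi0.mk (N.obj j) = Pi0.mk (col (f.e j).1) :=
    (Pi0.mk_eq_mk_iff _ _).2 ⟨(Groupoid.isoEquivHom (N.obj j) (col (f.e j).1)).symm (f.φ j)⟩
  rw [← Nat.card_fin (n i)]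
  refine Nat.card_congr ((Equiv.sigmaSubtype (β := fun i => Fin (n i)) i).symm.trans
    (f.e.subtypeEquiv fun j => ?_).symm)
  rw [h j]
  exact hcol.1.eq_iff

theorem rootHomCard_congr {v w : I} (f : v ⟶ w) : rootHomCard (P := P) v = rootHomCard w :=
  funext fun x => Nat.card_congr
    { toFun := fun g => g ≫ f
      invFun := fun g => g ≫ inv f
      left_inv := fun g => by simp
      right_inv := fun g => by simp }

/-- A Green function depends only on the isomorphism class of its colour, so the power can be spread
over the members of any family with this profile. -/
theorem greenPow_eq (hP : ∀ T : Trees P, Finite (Aut T)) {n : Fin s → ℕ} {N : Fam I} [Fintype N.ι]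
    (f : N ⟶ profile col n) : greenPow P col n = ∏ j, green P (N.obj j) := by
  have h1 : greenPow P col n = ∏ x : Σ i, Fin (n i), green P (col x.1) := by
    rw [Fintype.prod_sigma]
    simp [greenPow]
  rw [h1]
  let : Fintype (profile col n).ι := inferInstanceAs (Fintype (Σ i, Fin (n i)))
  refine (Fintype.prod_equiv f.e _ _ fun j => ?_).symm
  rw [green_eq hP, green_eq hP, rootHomCard_congr (f.φ j)]
  rfl

end Profile

/-! ### Comparison of coefficients -/

section Main

theorem card_hom_congr {G : Type u} [Category.{v} G] [IsGroupoid G] {x y : G} (f : x ⟶ y) (z : G) :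
    Nat.card (x ⟶ z) = Nat.card (y ⟶ z) :=
  Nat.card_congr
    { toFun := fun g => inv f ≫ g
      invFun := fun g => f ≫ g
      left_inv := fun g => by simp
      right_inv := fun g => by simp }

/-- A cut contains the root of the tree, which is also the root of the tree below it, so the root
colour is unchanged. -/
theorem rootHomCard_eq_of_cut {x y : Pi0 (Trees P)} {d : Mon P}
    (h : Nat.card (CutsOf x.rep.of y d) ≠ 0) (v : I) : rootHomCard v x = rootHomCard v y := by
  obtain ⟨⟨c, hc, _⟩⟩ := (Nat.card_ne_zero.1 h).1
  obtain ⟨f⟩ := (Pi0.mk_eq_mk_iff _ y.rep).1 (hc.trans (Pi0.mk_rep y).symm)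
  have hr : x.rep.of.α x.rep.of.tree.root = (rootMap P).obj ⟨x.rep.of.restrict c.1⟩ :=
    congrArg x.rep.of.α (c.1.root_eq c.2).symm
  exact card_hom_congr (eqToHom hr ≫ (rootMap P).map f.hom) v

variable (hP : ∀ T : Trees P, Finite (Aut T))

-- The root factor is the same for every tree that has a relevant cut and comes out of the sum,
-- which is then the weighted count of cuts.
include hP in
theorem comulSeries_green_single (v : I) (d : Mon P) (y : Pi0 (Trees P)) :
    comulSeries (green P v) (d, Finsupp.single y 1) =
      (∑ x ∈ (finite_familyMon_eq (ι := y.rep.of.tree.Leaf) d).toFinset,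
        ∏ l, (rootHomCard (y.rep.of.α l.1) (x l) : ℚ) / autCard (x l)) *
      ((rootHomCard v y : ℚ) / autCard y) := by
  rw [green_eq hP, comulSeries_linearSeries, ← mul_div_assoc, mul_div_right_comm,
    ← finsum_card_cutsOf_div hP, finsum_mul]
  refine finsum_congr fun x => ?_
  rw [tensorCoeff_comul_X_single]
  by_cases h : Nat.card (CutsOf x.rep.of y d) = 0
  · simp [h]
  · rw [rootHomCard_eq_of_cut h]
    ring

variable {s : ℕ} (col : Fin s → I)

open Classical in
include hP in
theorem tensorSeries_single (v : I) (n : Fin s → ℕ) (d : Mon P) (y : Pi0 (Trees P)) :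
    tensorSeries (greenPow P col n) (greenSummand P col n v) (d, Finsupp.single y 1) =
      if Nonempty ((leafMap P).obj y.rep ⟶ profile col n) then
        (∑ x ∈ (finite_familyMon_eq (ι := y.rep.of.tree.Leaf) d).toFinset,
          ∏ l, (rootHomCard (y.rep.of.α l.1) (x l) : ℚ) / autCard (x l)) *
        ((rootHomCard v y : ℚ) / autCard y) else 0 := by
  rw [tensorSeries, greenSummand, coeff_linearSeries_single, relCard_summandProj hP, mul_ite,
    mul_zero]
  refine if_ctx_congr Iff.rfl (fun ⟨f⟩ => ?_) fun _ => rfl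
  let : Fintype ((leafMap P).obj y.rep).ι := y.rep.of.tree.fintypeLeaf
  congr 1
  rw [greenPow_eq hP f]
  simp_rw [green_eq hP]
  exact coeff_prod_linearSeries (ι := y.rep.of.tree.Leaf) _ d

theorem tensorSeries_eq_zero (v : I) (n : Fin s → ℕ) (d : Mon P × Mon P)
    (hd : ∀ y, d.2 ≠ Finsupp.single y 1) :
    tensorSeries (greenPow P col n) (greenSummand P col n v) d = 0 := by
  rw [tensorSeries, greenSummand, coeff_linearSeries_eq_zero _ hd, mul_zero]

end Main

end TreeBialgebra

theorem mainTheorem4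
    {I : Type u₁} [CategoryTheory.Groupoid.{v₁} I] {E : Type u₂} [CategoryTheory.Groupoid.{v₂} E]
    {B : Type u₃} [CategoryTheory.Groupoid.{v₃} B] (P : TreeBialgebra.PolyDiagram I E B)
    (hP : ∀ T : TreeBialgebra.Trees P, Finite (CategoryTheory.Aut T))
    {s : ℕ} (col : Fin s → I)
    (hcol : Function.Bijective fun i => TreeBialgebra.Pi0.mk (col i)) (v : I) :
    -- the relative cardinalities that define the Green functions are those of finite morphisms
    (∀ w : I, TreeBialgebra.IsFiniteMorphism (TreeBialgebra.treesOverProj P w)) ∧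
    (∀ n : Fin s → ℕ, TreeBialgebra.IsFiniteMorphism
      (TreeBialgebra.summandProj P (TreeBialgebra.profile col n) v)) ∧
    -- the comultiplication extends to power series
    TreeBialgebra.ComulExtends P ∧
    -- the sum over all multiindices is locally finite
    (∀ d : TreeBialgebra.Mon P × TreeBialgebra.Mon P,
      {n : Fin s → ℕ | TreeBialgebra.tensorSeries (TreeBialgebra.greenPow P col n)
        (TreeBialgebra.greenSummand P col n v) d ≠ 0}.Finite) ∧
    -- the formula, coefficient by coefficient
    (∀ d : TreeBialgebra.Mon P × TreeBialgebra.Mon P,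
      TreeBialgebra.comulSeries (TreeBialgebra.green P v) d =
        ∑ᶠ n : Fin s → ℕ, TreeBialgebra.tensorSeries (TreeBialgebra.greenPow P col n)
          (TreeBialgebra.greenSummand P col n v) d) := by
  refine ⟨TreeBialgebra.isFiniteMorphism_treesOverProj hP,
    fun n => TreeBialgebra.isFiniteMorphism_summandProj hP _ v, TreeBialgebra.comulExtends hP, ?_, ?_⟩
  · rintro ⟨d, d'⟩
    by_cases hd : ∀ y, d' ≠ Finsupp.single y 1
    · simp [TreeBialgebra.tensorSeries_eq_zero col v _ (d, d') hd]
    · push Not at hd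
      obtain ⟨y, rfl⟩ := hd
      refine Set.Subsingleton.finite fun n hn n' hn' => funext fun i => ?_
      have h (k : Fin s → ℕ) (hk : TreeBialgebra.tensorSeries (TreeBialgebra.greenPow P col k)
          (TreeBialgebra.greenSummand P col k v) (d, Finsupp.single y 1) ≠ 0) :
          Nonempty ((TreeBialgebra.leafMap P).obj y.rep ⟶ TreeBialgebra.profile col k) := by
        rw [TreeBialgebra.tensorSeries_single hP] at hk
        by_contra hne
        exact hk (if_neg hne)
      obtain ⟨f⟩ := h n hn
      obtain ⟨f'⟩ := h n' hn'
      rw [TreeBialgebra.eq_card_of_hom_profile hcol f, TreeBialgebra.eq_card_of_hom_profile hcol f']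
  · rintro ⟨d, d'⟩
    by_cases hd : ∀ y, d' ≠ Finsupp.single y 1
    · simp only [TreeBialgebra.tensorSeries_eq_zero col v _ (d, d') hd, finsum_zero]
      rw [TreeBialgebra.green_eq hP, TreeBialgebra.comulSeries_linearSeries]
      simp [TreeBialgebra.tensorCoeff_comul_X_eq_zero (d, d') hd]
    · push Not at hd
      obtain ⟨y, rfl⟩ := hd
      -- The profile of the leaves of `y` is the only multiindex that contributes.
      obtain ⟨n, ⟨f⟩⟩ := TreeBialgebra.exists_hom_profile hcol ((TreeBialgebra.leafMap P).obj y.rep)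
      rw [TreeBialgebra.comulSeries_green_single hP, finsum_eq_single _ n,
        TreeBialgebra.tensorSeries_single hP, if_pos ⟨f⟩]
      intro n' hn'
      rw [TreeBialgebra.tensorSeries_single hP, if_neg]
      rintro ⟨f'⟩
      refine hn' (funext fun i => ?_)
      rw [TreeBialgebra.eq_card_of_hom_profile hcol f, TreeBialgebra.eq_card_of_hom_profile hcol f']
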